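/- Let $d\in\{2,3\}$, let $\mathbb T^d=\prod_{i=1}^d[-X_i,X_i]$ ($X_i>0$) be a periodic box of volume $|\mathbb T^d|$, and let $\epsilon,\gamma,M>0$, $\omega\in(0,1)$, $\tilde\omega=\max\{\omega,1-\omega\}$. Put $W(s)=18(s^2-s)^2$, and let $f(s)=3s^2-2s^3$ for $0\le s\le 1$, $f(s)=0$ for $s<0$, $f(s)=1$ for $s>1$. For $g\in L^2(\mathbb T^d)$ let $(-\Delta)^{-1}g$ be the mean-zero periodic solution $v$ of $-\Delta v=g-\frac1{|\mathbb T^d|}\int_{\mathbb T^d}g\,dx$, and let $\|(-\Delta)^{-1}\|$ be the norm of this operator from $L^\infty(\mathbb T^d)$ to itself. Consider the penalized Allen–Cahn–Ohta–Kawasaki equation $$\partial_t\phi=\epsilon\Delta\phi-\frac1\epsilon W'(\phi)-\gamma\,(-\Delta)^{-1}(f(\phi)-\omega)\,f'(\phi)-M\int_{\mathbb T^d}(f(\phi)-\omega)\,dx\; f'(\phi),\qquad \phi(0)=\phi_0 .\tag{1}$$ A global weak solution of (1) is a function $\phi$ with $\phi\in C([0,T];L^p(\mathbb T^d))\cap L^\infty(0,T;H^1(\mathbb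 T^d))\cap L^2(0,T;H^2(\mathbb T^d))$ for all $T>0$ and $p\in[2,6)$, with $\phi(0)=\phi_0$, such that for every $T>0$ and $w\in L^2(\mathbb T^d)$ the derivative $\frac{d}{dt}\int_{\mathbb T^d}\phi(t,x)w(x)\,dx$, in the sense of distributions on $(0,T)$, is the integral over $\mathbb T^d$ of $w$ times the right-hand side of (1). **Theorem.** Let $\phi_0\in H^1(\mathbb T^d)$ with $0\le\phi_0\le1$ a.e., and suppose that $$\frac{\epsilon\tilde\omega}{6}\Big[\gamma\,\|(-\Delta)^{-1}\|+M|\mathbb T^d|\Big]\le 1 .$$ Then every global weak solution $\phi$ of (1) satisfies $0\le\phi(t)\le1$ a.e. in $\mathbb T^d$ for every $t>0$. The same holds if the factor $f'(\phi)$ in (1) is taken to be the polynomial $6\phi-6\phi^2$ for all values of $\phi$ (while $f$ in $f(\phi)-\omega$ remains the extended function). -/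

import Mathlib

open MeasureTheory Filter Topology
open scoped ENNReal NNReal

namespace ACOK

noncomputable section

/-- The periodic box `∏ i, [-X i, X i]`, i.e. `ℝᵈ` modulo the periods `2 * X i`. It carries the
product of the Lebesgue measures of the factors, of total mass `∏ i, 2 * X i`. -/
abbrev Torus {d : ℕ} (X : Fin d → ℝ) : Type := ∀ i : Fin d, AddCircle (2 * X i)

/-- The `k`-th Fourier mode `x ↦ exp (i ∑ j, (2 π k_j / (2 X_j)) x_j)` of the periodic box. -/
def mode {d : ℕ} (X : Fin d → ℝ) (k : Fin d → ℤ) (x : Torus X) : ℂ :=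
  ∏ i, fourier (k i) (x i)

/-- The squared length `|κ|²` of the wave vector `κ_j = 2 π k_j / (2 X_j)`; the mode `k` is an
eigenfunction of `-Δ` with this eigenvalue. -/
def waveSq {d : ℕ} (X : Fin d → ℝ) (k : Fin d → ℤ) : ℝ :=
  ∑ i, (2 * Real.pi * (k i : ℝ) / (2 * X i)) ^ 2

section Torus

variable {d : ℕ} {X : Fin d → ℝ} [∀ i, Fact (0 < 2 * X i)]

/-- The (normalized) Fourier coefficient `|𝕋|⁻¹ ∫ u(x) exp (-i κ·x) dx`. -/
def coeff (u : Torus X → ℝ) (k : Fin d → ℤ) : ℂ :=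
  ((volume (Set.univ : Set (Torus X))).toReal : ℂ)⁻¹ * ∫ x, (u x : ℂ) * mode X (-k) x

/-- The square of the `H^s` norm, `|𝕋| ∑ₖ (1 + |κ|²)^s |û(k)|²`. -/
def sobolevSq (s : ℕ) (u : Torus X → ℝ) : ℝ≥0∞ :=
  volume (Set.univ : Set (Torus X)) *
    ∑' k : Fin d → ℤ, ENNReal.ofReal ((1 + waveSq X k) ^ s * ‖coeff u k‖ ^ 2)

/-- Membership in the periodic Sobolev space `H^s`. -/
def MemH (s : ℕ) (u : Torus X → ℝ) : Prop :=
  MemLp u 2 volume ∧ sobolevSq s u < ∞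

/-- `v ∈ L²` is the image of `u` under the Fourier multiplier with symbol `m`. -/
def IsMultiplierImage (m : (Fin d → ℤ) → ℝ) (u v : Torus X → ℝ) : Prop :=
  MemLp v 2 volume ∧ ∀ k, coeff v k = (m k : ℂ) * coeff u k

open Classical in
/-- The Fourier multiplier with symbol `m`. The image in `L²` is unique up to null sets when it
exists; where it does not exist the value is set to `0`. -/
def multiplier (m : (Fin d → ℤ) → ℝ) (u : Torus X → ℝ) : Torus X → ℝ :=
  if h : ∃ v, IsMultiplierImage m u v then h.choose else 0

/-- The Laplacian, for `u ∈ H²`. -/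
def lap (u : Torus X → ℝ) : Torus X → ℝ :=
  multiplier (fun k => -waveSq X k) u

/-- `(-Δ)⁻¹` on `L²`: the symbol is `|κ|⁻²` on the nonzero modes and, as `0⁻¹ = 0`, it is `0` on the
zero mode. So `v = (-Δ)⁻¹ g` is the mean-free solution of `-Δ v = g - |𝕋|⁻¹ ∫ g`. -/
def invLap (g : Torus X → ℝ) : Torus X → ℝ :=
  multiplier (fun k => (waveSq X k)⁻¹) g

end Torus

/-- The norm of `(-Δ)⁻¹` as an operator from `L^∞` to `L^∞`: the optimal constant `C` in
`‖(-Δ)⁻¹ g‖ ≤ C ‖g‖`. -/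
def invLapNorm {d : ℕ} (X : Fin d → ℝ) [∀ i, Fact (0 < 2 * X i)] : ℝ≥0∞ :=
  sInf {C : ℝ≥0∞ | ∀ g : Torus X → ℝ, MemLp g ∞ volume →
    eLpNorm (invLap g) ∞ volume ≤ C * eLpNorm g ∞ volume}

/-- The double well potential `W(s) = 18 (s² - s)²`. -/
def doubleWell (s : ℝ) : ℝ := 18 * (s ^ 2 - s) ^ 2

/-- The polynomial `3 s² - 2 s³`. -/
def fPoly (s : ℝ) : ℝ := 3 * s ^ 2 - 2 * s ^ 3

/-- The extension `f` of `3 s² - 2 s³` from `[0, 1]` to `ℝ` by the constants `0` and `1`. -/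
def fExt (s : ℝ) : ℝ := if s < 0 then 0 else if s ≤ 1 then fPoly s else 1

section Equation

variable {d : ℕ} {X : Fin d → ℝ} [∀ i, Fact (0 < 2 * X i)]

/-- The right-hand side
`ε Δu - ε⁻¹ W'(u) - γ (-Δ)⁻¹(f(u) - ω) df(u) - M (∫ (f(u) - ω)) df(u)`,
where the function `df` is the factor written `f'` in the equation. -/
def rhs (ε γ M ω : ℝ) (df : ℝ → ℝ) (u : Torus X → ℝ) (x : Torus X) : ℝ :=
  ε * lap u x - 1 / ε * deriv doubleWell (u x)
    - γ * invLap (fun y => fExt (u y) - ω) x * df (u x)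
    - M * (∫ y, (fExt (u y) - ω)) * df (u x)

/-- `φ` (with `φ t x` the value at time `t ≥ 0` and position `x`) is a global weak solution of the
penalized Allen-Cahn-Ohta-Kawasaki equation with initial datum `φ₀`. (The time measurability
needed for `L^∞(0,T;H¹)` and `L²(0,T;H²)` follows from continuity into `L²`.) -/
structure IsGlobalWeakSolution (ε γ M ω : ℝ) (df : ℝ → ℝ) (φ₀ : Torus X → ℝ)
    (φ : ℝ → Torus X → ℝ) : Prop where
  /-- `φ(t) ∈ L^p` for `p ∈ [2, 6)` and `t ≥ 0` -/
  memLp : ∀ p : ℝ≥0∞, 2 ≤ p → p < 6 → ∀ t : ℝ, 0 ≤ t → MemLp (φ t) p volume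
  /-- `φ ∈ C([0, T]; L^p)` for `p ∈ [2, 6)` and every `T` -/
  continuous_Lp : ∀ p : ℝ≥0∞, 2 ≤ p → p < 6 → ∀ T : ℝ, 0 < T → ∀ s ∈ Set.Icc 0 T,
    Tendsto (fun t => eLpNorm (φ t - φ s) p volume) (𝓝[Set.Icc 0 T] s) (𝓝 0)
  /-- `φ ∈ L^∞(0, T; H¹)` -/
  bounded_H1 : ∀ T : ℝ, 0 < T → ∃ C : ℝ≥0,
    ∀ᵐ t ∂(volume.restrict (Set.Ioo 0 T)), sobolevSq 1 (φ t) ≤ C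
  /-- `φ ∈ L²(0, T; H²)` -/
  sq_integrable_H2 : ∀ T : ℝ, 0 < T → ∫⁻ t in Set.Ioo 0 T, sobolevSq 2 (φ t) < ∞
  /-- `φ(0) = φ₀` -/
  initial : φ 0 =ᵐ[volume] φ₀
  /-- for all `w ∈ L²`, `d/dt ∫ φ w = ∫ rhs(φ) w` in the sense of distributions on `(0, T)` -/
  equation : ∀ T : ℝ, 0 < T → ∀ w : Torus X → ℝ, MemLp w 2 volume →
    ∀ η : ℝ → ℝ, ContDiff ℝ (⊤ : ℕ∞) η → HasCompactSupport η → tsupport η ⊆ Set.Ioo 0 T →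
      -∫ t in Set.Ioo 0 T, deriv η t * ∫ x, φ t x * w x =
        ∫ t in Set.Ioo 0 T, η t * ∫ x, rhs ε γ M ω df (φ t) x * w x

end Equation

end

end ACOK

namespace ACOK

noncomputable section

open scoped ComplexConjugate

/-! ### Fourier modes as a Hilbert basis of `L²` of the torus -/

section Fourier

variable {d : ℕ} {X : Fin d → ℝ}

/-! Let `excess s` be the signed distance of `s` to `[0, 1]`. The energy `E(t) = ∫ excess(φ(t))² /
2` vanishes at time `0`, and it vanishes at time `t` exactly when `0 ≤ φ(t) ≤ 1` a.e., so it
suffices that `E` does not increase. Formally `E' = ∫ rhs(φ) excess(φ) ≤ 0`. The Laplacian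
contributes a nonpositive term because `excess` is monotone (`integral_lap_mul_nonpos`). The
smallness condition bounds the nonlocal factor by `6 / ε` (`ae_abs_nonlocal_le`), which is just what
the double well can absorb outside `[0, 1]` (`reaction_mul_excess_nonpos`).

To avoid a chain rule for weak solutions, time is discretized. Since `excess² / 2` is convex with
derivative `excess`, one has `E(t) - E(s) ≤ ∫ (φ(t) - φ(s)) excess(φ(t))`. Here the test function `w
= excess(φ(t))` is frozen, so the weak equation bounds the increment by a time integral of `∫
rhs(φ(τ)) w` (`IsGlobalWeakSolution.integral_mul_sub_le`). Replacing `w` by `excess(φ(τ))` makes the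
integrand nonpositive. The error is at most `∫ |rhs(φ(τ))| |φ(t) - φ(τ)|`, which Young's inequality
and uniform continuity in `L⁴` make smaller than `δ ρ(τ)`, with `ρ` integrable in time by the
`L²(0,T;H²)` bound (`integral_rhs_mul_excess_le`). Summing over a fine partition gives `E(T) - E(0)
≤ δ ∫ ρ` for every `δ > 0` (`le_of_increments_le`). -/

lemma mode_neg (k : Fin d → ℤ) (x : Torus X) : mode X (-k) x = conj (mode X k x) := by
  simp only [mode, Pi.neg_apply, fourier_neg, map_prod]

lemma mode_add_index (k l : Fin d → ℤ) (x : Torus X) :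
    mode X (k + l) x = mode X k x * mode X l x := by
  simp only [mode, Pi.add_apply, fourier_add, ← Finset.prod_mul_distrib]

lemma mode_zero (x : Torus X) : mode X 0 x = 1 := by
  simp [mode]

lemma mode_add (k : Fin d → ℤ) (x y : Torus X) :
    mode X k (x + y) = mode X k x * mode X k y := by
  simp only [mode, Pi.add_apply, fourier_apply, smul_add, AddCircle.toCircle_add, Circle.coe_mul,
    ← Finset.prod_mul_distrib]

lemma norm_mode (k : Fin d → ℤ) (x : Torus X) : ‖mode X k x‖ = 1 := by
  simp only [mode, fourier_apply, norm_prod]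
  exact Finset.prod_eq_one fun i _ => Circle.norm_coe _

lemma continuous_mode (k : Fin d → ℤ) : Continuous (mode X k) := by
  unfold mode
  fun_prop

lemma mode_single (k : Fin d → ℤ) (i : Fin d) (y : AddCircle (2 * X i)) :
    mode X k (Pi.single i y : Torus X) = fourier (k i) y := by
  unfold mode
  rw [Finset.prod_eq_single i]
  · simp
  · intro j _ hj
    rw [Pi.single_eq_of_ne hj, fourier_eval_zero]
  · simp

/-- The Fourier mode as a continuous function. -/
def modeMap (X : Fin d → ℝ) (k : Fin d → ℤ) : C(Torus X, ℂ) := ⟨mode X k, continuous_mode k⟩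

/-- The star subalgebra of the continuous functions generated by the Fourier modes. -/
def modeSubalgebra (X : Fin d → ℝ) : StarSubalgebra ℂ C(Torus X, ℂ) where
  toSubalgebra := Algebra.adjoin ℂ (Set.range (modeMap X))
  star_mem' := by
    change Algebra.adjoin ℂ (Set.range (modeMap X)) ≤
      star (Algebra.adjoin ℂ (Set.range (modeMap X)))
    refine Algebra.adjoin_le ?_
    rintro _ ⟨n, rfl⟩
    refine Algebra.subset_adjoin ⟨-n, ?_⟩
    ext1 x
    exact mode_neg n x

/-- A product of modes is a mode and the constant `1` is a mode, so the linear span is already an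
algebra. -/
lemma modeSubalgebra_coe :
    (modeSubalgebra X).toSubalgebra.toSubmodule = Submodule.span ℂ (Set.range (modeMap X)) := by
  apply Algebra.adjoin_eq_span_of_subset
  refine .trans (fun x ↦ Submonoid.closure_induction (fun _ ↦ id) ⟨0, ?_⟩ ?_) Submodule.subset_span
  · ext z
    exact mode_zero z
  · rintro _ _ _ _ ⟨m, rfl⟩ ⟨n, rfl⟩
    refine ⟨m + n, ?_⟩
    ext z
    exact mode_add_index m n z

variable [∀ i, Fact (0 < 2 * X i)]

lemma modeSubalgebra_separatesPoints : (modeSubalgebra X).SeparatesPoints := by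
  intro x y hxy
  rw [Ne, funext_iff, not_forall] at hxy
  obtain ⟨i, hi⟩ := hxy
  -- The mode of index `Pi.single i 1` depends on the `i`-th coordinate alone, and injectively.
  refine ⟨_, ⟨modeMap X (Pi.single i 1), Algebra.subset_adjoin ⟨Pi.single i 1, rfl⟩, rfl⟩, ?_⟩
  have key : ∀ z : Torus X, modeMap X (Pi.single i 1) z = AddCircle.toCircle (z i) := by
    intro z
    change mode X (Pi.single i 1) z = _
    unfold mode
    rw [Finset.prod_eq_single i]
    · simp
    · intro j _ hj
      rw [Pi.single_eq_of_ne hj, fourier_zero]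
    · simp
  change modeMap X (Pi.single i 1) x ≠ modeMap X (Pi.single i 1) y
  rw [key, key]
  intro h
  exact hi (AddCircle.injective_toCircle (Fact.out : 0 < 2 * X i).ne' (Circle.coe_injective h))

/-- Stone–Weierstrass for the star subalgebra of modes. -/
lemma span_modeMap_closure_eq_top :
    (Submodule.span ℂ (Set.range (modeMap X))).topologicalClosure = ⊤ := by
  rw [← modeSubalgebra_coe]
  exact congr_arg (Subalgebra.toSubmodule <| StarSubalgebra.toSubalgebra ·)
    (ContinuousMap.starSubalgebra_topologicalClosure_eq_top_of_separatesPoints _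
      modeSubalgebra_separatesPoints)

lemma volume_real_univ_pos : 0 < volume.real (Set.univ : Set (Torus X)) := by
  refine ENNReal.toReal_pos ?_ (measure_ne_top _ _)
  exact (IsOpen.measure_pos _ isOpen_univ Set.univ_nonempty).ne'

lemma integral_mode {k : Fin d → ℤ} (hk : k ≠ 0) : ∫ x, mode X k x = 0 := by
  obtain ⟨i, hi⟩ := Function.ne_iff.mp hk
  -- Translation by half a wavelength changes the sign of the mode, while the integral is
  -- translation invariant.
  set a : Torus X := Pi.single i (((2 * X i) / 2 / (k i) : ℝ) : AddCircle (2 * X i)) with ha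
  have h1 : mode X k a = -1 := by
    have := fourier_add_half_inv_index (T := 2 * X i) hi Fact.out 0
    rw [zero_add, fourier_eval_zero] at this
    rw [ha, mode_single, ← this]
  have h2 : ∫ x, mode X k (x + a) = ∫ x, mode X k x := integral_add_right_eq_self _ a
  simp only [mode_add, h1, integral_mul_const] at h2
  linear_combination (-1 / 2 : ℂ) * h2

/-- The `L²`-normalized Fourier modes. -/
def modeLp (X : Fin d → ℝ) [∀ i, Fact (0 < 2 * X i)] (k : Fin d → ℤ) :
    Lp ℂ 2 (volume : Measure (Torus X)) :=
  (((√(volume.real (Set.univ : Set (Torus X))))⁻¹ : ℝ) : ℂ) •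
    ContinuousMap.toLp (E := ℂ) 2 volume ℂ (modeMap X k)

lemma orthonormal_modeLp : Orthonormal ℂ (modeLp X) := by
  rw [orthonormal_iff_ite]
  intro k l
  have hpos := volume_real_univ_pos (X := X)
  have h : ∀ x : Torus X, modeMap X l x * conj (modeMap X k x) = mode X (l + -k) x := fun x => by
    rw [mode_add_index, mode_neg]
    rfl
  simp only [modeLp, inner_smul_left, inner_smul_right, ContinuousMap.inner_toLp, h]
  split_ifs with hkl
  · subst hkl
    simp only [add_neg_cancel, mode_zero, integral_const, Complex.conj_ofReal,
      Complex.real_smul, mul_one]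
    norm_cast
    nth_rewrite 3 [← Real.mul_self_sqrt hpos.le]
    have := (Real.sqrt_pos.2 hpos).ne'
    field_simp
  · rw [integral_mode, mul_zero, mul_zero]
    rw [← sub_eq_add_neg, sub_ne_zero]
    exact Ne.symm hkl

lemma span_modeLp_closure_eq_top :
    (Submodule.span ℂ (Set.range (modeLp X))).topologicalClosure = ⊤ := by
  have h1 : (Submodule.span ℂ (Set.range fun k =>
      ContinuousMap.toLp (E := ℂ) 2 (volume : Measure (Torus X)) ℂ
        (modeMap X k))).topologicalClosure = ⊤ := by
    simpa only [Submodule.map_span, ContinuousLinearMap.coe_coe, ← Set.range_comp,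
      Function.comp_def] using
      (ContinuousMap.toLp_denseRange ℂ (volume : Measure (Torus X)) ℂ
        (p := 2) (by simp)).topologicalClosure_map_submodule span_modeMap_closure_eq_top
  rw [← h1]
  congr 1
  have hc : (((√(volume.real (Set.univ : Set (Torus X))))⁻¹ : ℝ) : ℂ) ≠ 0 := by
    have := (Real.sqrt_pos.2 (volume_real_univ_pos (X := X))).ne'
    exact_mod_cast inv_ne_zero this
  refine le_antisymm (Submodule.span_le.2 ?_) (Submodule.span_le.2 ?_)
  · rintro _ ⟨k, rfl⟩
    exact Submodule.smul_mem _ _ (Submodule.subset_span ⟨k, rfl⟩)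
  · rintro _ ⟨k, rfl⟩
    have := Submodule.smul_mem _ (((√(volume.real (Set.univ : Set (Torus X))))⁻¹ : ℝ) : ℂ)⁻¹
      (Submodule.subset_span (R := ℂ) (Set.mem_range_self (f := modeLp X) k))
    rw [modeLp, inv_smul_smul₀ hc] at this
    exact this

/-- The normalized Fourier modes as a Hilbert basis of `L²`. -/
def modeBasis (X : Fin d → ℝ) [∀ i, Fact (0 < 2 * X i)] :
    HilbertBasis (Fin d → ℤ) ℂ (Lp ℂ 2 (volume : Measure (Torus X))) :=
  HilbertBasis.mk orthonormal_modeLp span_modeLp_closure_eq_top.ge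

lemma modeBasis_repr (F : Lp ℂ 2 (volume : Measure (Torus X))) (k : Fin d → ℤ) :
    (modeBasis X).repr F k = (((√(volume.real (Set.univ : Set (Torus X))))⁻¹ : ℝ) : ℂ) *
      ∫ x, F x * mode X (-k) x := by
  rw [HilbertBasis.repr_apply_apply, modeBasis, HilbertBasis.coe_mk, modeLp, inner_smul_left,
    Complex.conj_ofReal, L2.inner_def]
  congr 1
  apply integral_congr_ae
  filter_upwards [ContinuousMap.coeFn_toLp (𝕜 := ℂ) (p := 2) volume (modeMap X k)] with x hx
  rw [hx, mode_neg]
  simp [modeMap]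

end Fourier

/-! ### Parseval and Riesz–Fischer for real functions -/

section Parseval

variable {d : ℕ} {X : Fin d → ℝ} [∀ i, Fact (0 < 2 * X i)]

lemma integrable_ofReal_mul_mode {u : Torus X → ℝ} (hu : MemLp u 2 volume) (k : Fin d → ℤ) :
    Integrable (fun x => (u x : ℂ) * mode X k x) := by
  refine Integrable.mul_bdd (c := 1) (hu.integrable (by norm_num)).ofReal
    (continuous_mode k).aestronglyMeasurable ?_
  filter_upwards with x
  rw [norm_mode]

lemma coeff_sub {u v : Torus X → ℝ} (hu : MemLp u 2 volume) (hv : MemLp v 2 volume)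
    (k : Fin d → ℤ) : coeff (u - v) k = coeff u k - coeff v k := by
  unfold coeff
  rw [← mul_sub, ← integral_sub (integrable_ofReal_mul_mode hu _)
    (integrable_ofReal_mul_mode hv _)]
  simp [sub_mul]

lemma coeff_neg (u : Torus X → ℝ) (k : Fin d → ℤ) : coeff u (-k) = conj (coeff u k) := by
  unfold coeff
  rw [map_mul, map_inv₀, Complex.conj_ofReal, ← integral_conj]
  congr 2
  funext x
  rw [map_mul, Complex.conj_ofReal, ← mode_neg]

lemma coeff_comp_add_right (u : Torus X → ℝ) (a : Torus X) (k : Fin d → ℤ) :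
    coeff (fun x => u (x + a)) k = mode X k a * coeff u k := by
  unfold coeff
  rw [← integral_add_right_eq_self (fun x => (u x : ℂ) * mode X (-k) x) a, mul_left_comm]
  congr 1
  rw [← integral_const_mul]
  congr 1
  funext x
  have h : mode X k a * mode X (-k) a = 1 := by
    rw [← mode_add_index, add_neg_cancel, mode_zero]
  rw [mode_add]
  linear_combination (-(u (x + a) : ℂ) * mode X (-k) x) * h

/-- A real square-integrable function as an element of the complex `L²` space. -/
def toComplexLp {u : Torus X → ℝ} (hu : MemLp u 2 volume) :
    Lp ℂ 2 (volume : Measure (Torus X)) := (MemLp.ofReal (K := ℂ) hu).toLp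

lemma coeFn_toComplexLp {u : Torus X → ℝ} (hu : MemLp u 2 volume) :
    toComplexLp hu =ᵐ[volume] fun x => (u x : ℂ) := MemLp.coeFn_toLp _

lemma inv_sqrt_eq_sqrt_mul_inv :
    (((√(volume.real (Set.univ : Set (Torus X))))⁻¹ : ℝ) : ℂ) =
      ((√(volume.real (Set.univ : Set (Torus X))) : ℝ) : ℂ) *
        ((volume (Set.univ : Set (Torus X))).toReal : ℂ)⁻¹ := by
  have hpos := volume_real_univ_pos (X := X)
  change _ = _ * ((volume.real (Set.univ : Set (Torus X)) : ℝ) : ℂ)⁻¹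
  norm_cast
  nth_rewrite 3 [← Real.mul_self_sqrt hpos.le]
  have := (Real.sqrt_pos.2 hpos).ne'
  field_simp

lemma modeBasis_repr_toComplexLp {u : Torus X → ℝ} (hu : MemLp u 2 volume) (k : Fin d → ℤ) :
    (modeBasis X).repr (toComplexLp hu) k =
      ((√(volume.real (Set.univ : Set (Torus X))) : ℝ) : ℂ) * coeff u k := by
  rw [modeBasis_repr, inv_sqrt_eq_sqrt_mul_inv, coeff, mul_assoc]
  congr 2
  apply integral_congr_ae
  filter_upwards [coeFn_toComplexLp hu] with x hx
  rw [hx]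

/-- Parseval's identity for real functions. -/
lemma hasSum_conj_coeff_mul_coeff {u v : Torus X → ℝ} (hu : MemLp u 2 volume)
    (hv : MemLp v 2 volume) :
    HasSum (fun k => (volume.real (Set.univ : Set (Torus X)) : ℂ) *
      (conj (coeff u k) * coeff v k)) ((∫ x, u x * v x : ℝ) : ℂ) := by
  have h := (modeBasis X).hasSum_inner_mul_inner (toComplexLp hu) (toComplexLp hv)
  have h1 : inner ℂ (toComplexLp hu) (toComplexLp hv) = ((∫ x, u x * v x : ℝ) : ℂ) := by
    rw [L2.inner_def, ← integral_complex_ofReal]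
    apply integral_congr_ae
    filter_upwards [coeFn_toComplexLp hu, coeFn_toComplexLp hv] with x hx hy
    rw [hx, hy]
    simp [mul_comm]
  rw [h1] at h
  refine h.congr_fun fun k => ?_
  rw [← inner_conj_symm (toComplexLp hu), ← HilbertBasis.repr_apply_apply,
    ← HilbertBasis.repr_apply_apply, modeBasis_repr_toComplexLp, modeBasis_repr_toComplexLp,
    map_mul, Complex.conj_ofReal]
  have : (volume.real (Set.univ : Set (Torus X)) : ℂ) =
      ((√(volume.real (Set.univ : Set (Torus X))) : ℝ) : ℂ) *
      ((√(volume.real (Set.univ : Set (Torus X))) : ℝ) : ℂ) := by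
    rw [← Complex.ofReal_mul, Real.mul_self_sqrt volume_real_univ_pos.le]
  rw [this]
  ring

lemma hasSum_sq_norm_coeff {u : Torus X → ℝ} (hu : MemLp u 2 volume) :
    HasSum (fun k => volume.real (Set.univ : Set (Torus X)) * ‖coeff u k‖ ^ 2)
      (∫ x, u x ^ 2) := by
  have h := Complex.hasSum_re (hasSum_conj_coeff_mul_coeff hu hu)
  rw [Complex.ofReal_re] at h
  simp only [pow_two (u _)]
  refine h.congr_fun fun k => ?_
  rw [mul_comm (conj _), Complex.mul_conj, Complex.normSq_eq_norm_sq, ← Complex.ofReal_mul,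
    Complex.ofReal_re]

lemma summable_sq_norm_coeff {u : Torus X → ℝ} (hu : MemLp u 2 volume) :
    Summable (fun k => ‖coeff u k‖ ^ 2) :=
  (summable_mul_left_iff (volume_real_univ_pos (X := X)).ne').1 (hasSum_sq_norm_coeff hu).summable

/-- The Riesz-Fischer theorem for real functions. -/
lemma exists_coeff_eq {c : (Fin d → ℤ) → ℂ} (hc : ∀ k, c (-k) = conj (c k))
    (hs : Summable fun k => ‖c k‖ ^ 2) :
    ∃ v : Torus X → ℝ, MemLp v 2 volume ∧ ∀ k, coeff v k = c k := by
  set r : ℂ := ((√(volume.real (Set.univ : Set (Torus X))) : ℝ) : ℂ) with hr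
  have hr0 : r ≠ 0 := by
    rw [hr]
    exact_mod_cast (Real.sqrt_pos.2 (volume_real_univ_pos (X := X))).ne'
  have hmem : Memℓp (fun k => r * c k) 2 := by
    rw [memℓp_gen_iff (by norm_num)]
    simpa [mul_pow] using hs.mul_left (‖r‖ ^ 2)
  set F : Lp ℂ 2 (volume : Measure (Torus X)) := (modeBasis X).repr.symm ⟨_, hmem⟩ with hF
  have hcoef : ∀ k, ((volume (Set.univ : Set (Torus X))).toReal : ℂ)⁻¹ *
      ∫ x, F x * mode X (-k) x = c k := by
    intro k
    have h1 : (modeBasis X).repr F k = r * c k := by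
      rw [hF, LinearIsometryEquiv.apply_symm_apply]
    rw [modeBasis_repr, inv_sqrt_eq_sqrt_mul_inv, mul_assoc] at h1
    exact mul_left_cancel₀ hr0 h1
  have hFm := Lp.memLp F
  -- `F` is not known to be real. The `k`-th coefficient of its real part is the mean of `c k` and
  -- `conj (c (-k))`, which agree by `hc`.
  refine ⟨fun x => (F x).re, hFm.re, fun k => ?_⟩
  have hint : ∀ k, Integrable (fun x => F x * mode X k x) := fun k => by
    refine Integrable.mul_bdd (c := 1) (hFm.integrable (by norm_num))
      (continuous_mode k).aestronglyMeasurable ?_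
    filter_upwards with x
    rw [norm_mode]
  have hconj : ∀ k, Integrable (fun x => conj (F x * mode X k x)) := fun k =>
    (hint k).congr'_enorm (Complex.continuous_conj.comp_aestronglyMeasurable (hint k).1) (by simp)
  have h2 : ∀ x, (((F x).re : ℝ) : ℂ) * mode X (-k) x =
      (1 / 2 : ℂ) * (F x * mode X (-k) x + conj (F x * mode X k x)) := by
    intro x
    rw [Complex.re_eq_add_conj, map_mul, ← mode_neg]
    ring
  unfold coeff
  simp only [h2]
  rw [integral_const_mul, integral_add (hint _) (hconj k), integral_conj]
  have h3 := hcoef k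
  have h4 := congrArg conj (hcoef (-k))
  rw [hc, Complex.conj_conj, map_mul, map_inv₀, Complex.conj_ofReal, neg_neg] at h4
  linear_combination (1 / 2 : ℂ) * h3 + (1 / 2 : ℂ) * h4

end Parseval

/-! ### The Laplacian as a Fourier multiplier, tested with monotone functions -/

section Laplacian

variable {d : ℕ} {X : Fin d → ℝ}

lemma waveSq_nonneg (k : Fin d → ℤ) : 0 ≤ waveSq X k :=
  Finset.sum_nonneg fun _ _ => sq_nonneg _

lemma waveSq_neg (k : Fin d → ℤ) : waveSq X (-k) = waveSq X k := by
  unfold waveSq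
  refine Finset.sum_congr rfl fun i _ => ?_
  simp only [Pi.neg_apply, Int.cast_neg]
  ring

variable [∀ i, Fact (0 < 2 * X i)]

lemma isMultiplierImage_multiplier {m : (Fin d → ℤ) → ℝ} {u : Torus X → ℝ}
    (h : ∃ v, IsMultiplierImage m u v) : IsMultiplierImage m u (multiplier m u) := by
  unfold multiplier
  rw [dif_pos h]
  exact h.choose_spec

lemma aestronglyMeasurable_multiplier (m : (Fin d → ℤ) → ℝ) (u : Torus X → ℝ) :
    AEStronglyMeasurable (multiplier m u) volume := by
  by_cases h : ∃ v, IsMultiplierImage m u v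
  · exact (isMultiplierImage_multiplier h).1.1
  · unfold multiplier
    rw [dif_neg h]
    exact aestronglyMeasurable_zero

lemma summable_of_sobolevSq_lt_top {s : ℕ} {u : Torus X → ℝ} (hS : sobolevSq s u < ∞) :
    Summable fun k => (1 + waveSq X k) ^ s * ‖coeff u k‖ ^ 2 := by
  have hne : ∑' k, ENNReal.ofReal ((1 + waveSq X k) ^ s * ‖coeff u k‖ ^ 2) ≠ ∞ := by
    intro h
    have hv : volume (Set.univ : Set (Torus X)) ≠ 0 :=
      (IsOpen.measure_pos _ isOpen_univ Set.univ_nonempty).ne'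
    rw [sobolevSq, h, ENNReal.mul_top hv] at hS
    exact lt_irrefl _ hS
  refine (ENNReal.summable_toReal hne).congr fun k => ?_
  have := waveSq_nonneg (X := X) k
  rw [ENNReal.toReal_ofReal (by positivity)]

lemma toReal_sobolevSq (s : ℕ) (u : Torus X → ℝ) :
    (sobolevSq s u).toReal = volume.real (Set.univ : Set (Torus X)) *
      ∑' k, (1 + waveSq X k) ^ s * ‖coeff u k‖ ^ 2 := by
  rw [sobolevSq, ENNReal.toReal_mul, ENNReal.tsum_toReal_eq fun _ => ENNReal.ofReal_ne_top]
  congr 1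
  refine tsum_congr fun k => ?_
  have := waveSq_nonneg (X := X) k
  rw [ENNReal.toReal_ofReal (by positivity)]

lemma sq_norm_waveSq_mul_coeff_le (u : Torus X → ℝ) (k : Fin d → ℤ) :
    ‖((-waveSq X k : ℝ) : ℂ) * coeff u k‖ ^ 2 ≤ (1 + waveSq X k) ^ 2 * ‖coeff u k‖ ^ 2 := by
  have := waveSq_nonneg (X := X) k
  rw [norm_mul, mul_pow, Complex.norm_real, Real.norm_eq_abs, sq_abs, neg_sq]
  gcongr
  linarith

/-- Rules out the default value `0` of `multiplier`: the `H²` bound makes the target coefficients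
square summable, so Riesz–Fischer supplies an image. -/
lemma isMultiplierImage_lap {u : Torus X → ℝ} (hS : sobolevSq 2 u < ∞) :
    IsMultiplierImage (fun k => -waveSq X k) u (lap u) := by
  apply isMultiplierImage_multiplier
  obtain ⟨v, hv, hvc⟩ := exists_coeff_eq (X := X)
    (c := fun k => ((-waveSq X k : ℝ) : ℂ) * coeff u k)
    (fun k => by rw [waveSq_neg, coeff_neg, map_mul, Complex.conj_ofReal])
    (Summable.of_nonneg_of_le (fun k => by positivity) (sq_norm_waveSq_mul_coeff_le u)
      (summable_of_sobolevSq_lt_top hS))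
  exact ⟨v, hv, hvc⟩

lemma memLp_lap {u : Torus X → ℝ} (hS : sobolevSq 2 u < ∞) : MemLp (lap u) 2 volume :=
  (isMultiplierImage_lap hS).1

lemma coeff_lap {u : Torus X → ℝ} (hS : sobolevSq 2 u < ∞) (k : Fin d → ℤ) :
    coeff (lap u) k = ((-waveSq X k : ℝ) : ℂ) * coeff u k :=
  (isMultiplierImage_lap hS).2 k

lemma integral_sq_lap_le {u : Torus X → ℝ} (hS : sobolevSq 2 u < ∞) :
    ∫ x, lap u x ^ 2 ≤ (sobolevSq 2 u).toReal := by
  have h := hasSum_sq_norm_coeff (memLp_lap hS)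
  rw [toReal_sobolevSq, ← tsum_mul_left]
  refine hasSum_le (fun k => ?_) h ((summable_of_sobolevSq_lt_top hS).mul_left _).hasSum
  rw [coeff_lap hS]
  gcongr
  exact sq_norm_waveSq_mul_coeff_le u k

lemma memLp_comp_add_right {p : ℝ≥0∞} {u : Torus X → ℝ} (hu : MemLp u p volume) (a : Torus X) :
    MemLp (fun x => u (x + a)) p volume :=
  hu.comp_measurePreserving (measurePreserving_add_right volume a)

/-- Parseval's identity for the product of two differences. -/
lemma hasSum_integral_sub_mul_sub {u w : Torus X → ℝ} (hu : MemLp u 2 volume)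
    (hw : MemLp w 2 volume) (a : Torus X) :
    HasSum (fun k => (‖mode X k a - 1‖ ^ 2 : ℝ) * ((volume.real (Set.univ : Set (Torus X)) : ℂ) *
        (conj (coeff u k) * coeff w k)))
      ((∫ x, (u (x + a) - u x) * (w (x + a) - w x) : ℝ) : ℂ) := by
  have hu' := memLp_comp_add_right hu a
  have hw' := memLp_comp_add_right hw a
  refine (hasSum_conj_coeff_mul_coeff (hu'.sub hu) (hw'.sub hw)).congr_fun fun k => ?_
  rw [coeff_sub hu' hu, coeff_sub hw' hw, coeff_comp_add_right, coeff_comp_add_right,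
    ← Complex.normSq_eq_norm_sq, ← Complex.mul_conj]
  simp only [map_sub, map_mul, map_one]
  ring

omit [∀ i, Fact (0 < 2 * X i)] in
lemma mode_single_coe (k : Fin d → ℤ) (i : Fin d) (h : ℝ) :
    mode X k (Pi.single i (h : AddCircle (2 * X i)) : Torus X) =
      Complex.exp (Complex.I * ((2 * Real.pi * (k i : ℝ) / (2 * X i) * h : ℝ) : ℂ)) := by
  rw [mode_single, fourier_coe_apply]
  congr 1
  push_cast
  ring

/-- This and the next bound let difference quotients replace derivatives on the Fourier side: the
symbol of the squared quotient tends to `κ²` and is dominated by it. -/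
lemma tendsto_norm_exp_sub_one_div (κ : ℝ) :
    Tendsto (fun h : ℝ => (‖Complex.exp (Complex.I * ((κ * h : ℝ) : ℂ)) - 1‖ / h) ^ 2)
      (𝓝[≠] 0) (𝓝 (κ ^ 2)) := by
  have h1 : HasDerivAt (fun h : ℝ => Complex.exp (Complex.I * ((κ * h : ℝ) : ℂ)))
      (Complex.I * κ) 0 := by
    have h2 : HasDerivAt (fun h : ℝ => Complex.I * ((κ * h : ℝ) : ℂ)) (Complex.I * κ) 0 := by
      have := ((hasDerivAt_id (0 : ℝ)).const_mul κ).ofReal_comp.const_mul Complex.I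
      simpa using this
    simpa using h2.cexp
  have h3 := ((hasDerivAt_iff_tendsto_slope_zero.1 h1).norm).pow 2
  simp only [zero_add, mul_zero, Complex.ofReal_zero, Complex.exp_zero, norm_smul, norm_mul,
    Complex.norm_I, one_mul, Complex.norm_real, Real.norm_eq_abs, sq_abs] at h3
  refine h3.congr fun h => ?_
  rw [abs_inv, div_pow, mul_pow, inv_pow, sq_abs]
  ring

lemma norm_exp_sub_one_div_sq_le (κ h : ℝ) :
    (‖Complex.exp (Complex.I * ((κ * h : ℝ) : ℂ)) - 1‖ / h) ^ 2 ≤ κ ^ 2 := by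
  have h1 : ‖Complex.exp (Complex.I * ((κ * h : ℝ) : ℂ)) - 1‖ ≤ ‖κ * h‖ :=
    Real.norm_exp_I_mul_ofReal_sub_one_le
  rcases eq_or_ne h 0 with rfl | hh
  · rw [div_zero, zero_pow two_ne_zero]
    exact sq_nonneg κ
  · rw [div_pow, div_le_iff₀ (by positivity), ← mul_pow, ← sq_abs (κ * h)]
    gcongr
    exact h1

/-- If `w` varies monotonically with `u`, then `∫ Δu w ≤ 0`. -/
lemma integral_lap_mul_nonpos {u w : Torus X → ℝ} (hu : MemLp u 2 volume)
    (hw : MemLp w 2 volume) (hS : sobolevSq 2 u < ∞)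
    (hmono : ∀ x y, 0 ≤ (u x - u y) * (w x - w y)) :
    ∫ x, lap u x * w x ≤ 0 := by
  set κ : Fin d → (Fin d → ℤ) → ℝ := fun i k => 2 * Real.pi * (k i : ℝ) / (2 * X i) with hκ
  set p : (Fin d → ℤ) → ℂ := fun k => (volume.real (Set.univ : Set (Torus X)) : ℂ) *
        (conj (coeff u k) * coeff w k) with hp
  have hκle : ∀ i k, κ i k ^ 2 ≤ waveSq X k := fun i k =>
    Finset.single_le_sum (f := fun i => κ i k ^ 2) (fun _ _ => sq_nonneg _) (Finset.mem_univ i)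
  have hsum : Summable fun k => waveSq X k * ‖p k‖ := by
    have h1 := ((summable_of_sobolevSq_lt_top hS).add (summable_sq_norm_coeff hw)).mul_left
      (volume.real (Set.univ : Set (Torus X)))
    refine Summable.of_nonneg_of_le (fun k => mul_nonneg (waveSq_nonneg k) (norm_nonneg _))
      (fun k => ?_) h1
    have h2 := waveSq_nonneg (X := X) k
    rw [hp, norm_mul, norm_mul, Complex.norm_real, Real.norm_of_nonneg measureReal_nonneg,
      RCLike.norm_conj]
    have h3 : waveSq X k * (‖coeff u k‖ * ‖coeff w k‖) ≤
        (1 + waveSq X k) ^ 2 * ‖coeff u k‖ ^ 2 + ‖coeff w k‖ ^ 2 := by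
      have h4 : waveSq X k * (‖coeff u k‖ * ‖coeff w k‖) ≤
        (1 + waveSq X k) * ‖coeff u k‖ * ‖coeff w k‖ := by
        rw [mul_assoc]
        gcongr
        linarith
      nlinarith [sq_nonneg ((1 + waveSq X k) * ‖coeff u k‖ - ‖coeff w k‖),
        sq_nonneg ((1 + waveSq X k) * ‖coeff u k‖), sq_nonneg ‖coeff w k‖]
    calc _ = volume.real (Set.univ : Set (Torus X)) *
          (waveSq X k * (‖coeff u k‖ * ‖coeff w k‖)) := by ring
      _ ≤ _ := by gcongr
  have hsumi : ∀ i, Summable fun k => ((κ i k ^ 2 : ℝ) : ℂ) * p k := fun i => by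
    refine Summable.of_norm_bounded hsum fun k => ?_
    rw [norm_mul, Complex.norm_real, Real.norm_of_nonneg (sq_nonneg _)]
    gcongr
    exact hκle i k
  have hi : ∀ i, 0 ≤ (∑' k, ((κ i k ^ 2 : ℝ) : ℂ) * p k).re := by
    intro i
    -- The `i`-th part of `-∫ Δu w` is the limit of `h⁻² ∫ (u(x + h eᵢ) - u(x)) (w(x + h eᵢ) -
    -- w(x))`, whose integrand is nonnegative by `hmono`. No weak gradient or chain rule for `w` is
    -- needed.
    have hlim : Tendsto (fun h : ℝ => ∑' k,
        (((‖Complex.exp (Complex.I * ((κ i k * h : ℝ) : ℂ)) - 1‖ / h) ^ 2 : ℝ) : ℂ) * p k)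
        (𝓝[≠] 0) (𝓝 (∑' k, ((κ i k ^ 2 : ℝ) : ℂ) * p k)) := by
      refine tendsto_tsum_of_dominated_convergence hsum (fun k => ?_) (.of_forall fun h k => ?_)
      · exact ((Complex.continuous_ofReal.tendsto _).comp
          (tendsto_norm_exp_sub_one_div (κ i k))).mul_const _
      · rw [norm_mul, Complex.norm_real, Real.norm_of_nonneg (sq_nonneg _)]
        gcongr
        exact (norm_exp_sub_one_div_sq_le _ _).trans (hκle i k)
    refine ge_of_tendsto ((Complex.continuous_re.tendsto _).comp hlim) (.of_forall fun h => ?_)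
    have h1 := (hasSum_integral_sub_mul_sub hu hw
      (Pi.single i (h : AddCircle (2 * X i)) : Torus X)).mul_left (((h ^ 2)⁻¹ : ℝ) : ℂ)
    have h2 : (∑' k, (((‖Complex.exp (Complex.I * ((κ i k * h : ℝ) : ℂ)) - 1‖ / h) ^ 2 : ℝ) : ℂ) *
        p k) = (((h ^ 2)⁻¹ : ℝ) : ℂ) * ((∫ x, (u (x + Pi.single i (h : AddCircle (2 * X i))) - u x) *
          (w (x + Pi.single i (h : AddCircle (2 * X i))) - w x) : ℝ) : ℂ) := by
      rw [← h1.tsum_eq]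
      refine tsum_congr fun k => ?_
      rw [mode_single_coe]
      change _ = _ * (((‖Complex.exp (Complex.I * ((κ i k * h : ℝ) : ℂ)) - 1‖ ^ 2 : ℝ) : ℂ) * p k)
      push_cast
      ring
    refine le_of_le_of_eq ?_ (congrArg Complex.re h2).symm
    rw [← Complex.ofReal_mul, Complex.ofReal_re]
    refine mul_nonneg (by positivity) (integral_nonneg fun x => hmono _ _)
  have hfin : ((∫ x, lap u x * w x : ℝ) : ℂ) = -∑ i, ∑' k, ((κ i k ^ 2 : ℝ) : ℂ) * p k := by
    rw [← (hasSum_conj_coeff_mul_coeff (memLp_lap hS) hw).tsum_eq,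
      ← Summable.tsum_finsetSum fun i _ => hsumi i, ← tsum_neg]
    refine tsum_congr fun k => ?_
    rw [coeff_lap hS, map_mul, Complex.conj_ofReal, ← Finset.sum_mul, ← Complex.ofReal_sum,
      hp]
    change _ = -(((waveSq X k : ℝ) : ℂ) * _)
    push_cast
    ring
  have h := congrArg Complex.re hfin
  rw [Complex.ofReal_re, Complex.neg_re, Complex.re_sum] at h
  rw [h]
  exact neg_nonpos.2 (Finset.sum_nonneg fun i _ => hi i)

end Laplacian

/-! ### The `L^∞` bound for the inverse Laplacian -/

section InverseLaplacian

variable {d : ℕ} {X : Fin d → ℝ} [∀ i, Fact (0 < 2 * X i)]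

lemma aestronglyMeasurable_invLap (g : Torus X → ℝ) : AEStronglyMeasurable (invLap g) volume :=
  aestronglyMeasurable_multiplier _ g

/-- The operator bound for `(-Δ)⁻¹` on `L^∞`. -/
lemma ae_abs_invLap_le (hN : invLapNorm X ≠ ∞) {g : Torus X → ℝ} (hg : MemLp g ∞ volume) {B : ℝ}
    (hB : ∀ᵐ x, |g x| ≤ B) :
    ∀ᵐ x, |invLap g x| ≤ (invLapNorm X).toReal * B := by
  have hB0 : 0 ≤ B := by
    obtain ⟨x, hx⟩ := hB.exists
    exact (abs_nonneg _).trans hx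
  have h1 : eLpNorm g ∞ volume ≤ ENNReal.ofReal B := by
    rw [eLpNorm_exponent_top]
    exact eLpNormEssSup_le_of_ae_bound hB
  have h2 : eLpNorm (invLap g) ∞ volume ≤ invLapNorm X * ENNReal.ofReal B := by
    -- The infimum defining the norm need not be known to be attained, so a slightly larger
    -- admissible constant is used; the `+ 1` covers `B = 0`.
    refine ENNReal.le_of_forall_pos_le_add fun δ hδ _ => ?_
    have hδ' : 0 < (δ : ℝ≥0∞) / (ENNReal.ofReal B + 1) :=
      ENNReal.div_pos (by exact_mod_cast hδ.ne') (by finiteness)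
    obtain ⟨C, hC, hCN⟩ := sInf_lt_iff.1 (ENNReal.lt_add_right hN hδ'.ne')
    calc eLpNorm (invLap g) ∞ volume ≤ C * eLpNorm g ∞ volume := hC g hg
      _ ≤ (invLapNorm X + δ / (ENNReal.ofReal B + 1)) * ENNReal.ofReal B := by
        gcongr
        exact hCN.le
      _ = invLapNorm X * ENNReal.ofReal B + δ / (ENNReal.ofReal B + 1) * ENNReal.ofReal B := by
        rw [add_mul]
      _ ≤ invLapNorm X * ENNReal.ofReal B +
          δ / (ENNReal.ofReal B + 1) * (ENNReal.ofReal B + 1) := by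
        gcongr
        exact le_self_add
      _ = _ := by
        rw [ENNReal.div_mul_cancel (by simp) (by finiteness)]
  filter_upwards [ae_le_eLpNormEssSup (f := invLap g) (μ := volume)] with x hx
  rw [← eLpNorm_exponent_top] at hx
  have h3 := ENNReal.toReal_mono (by finiteness) (hx.trans h2)
  rwa [toReal_enorm, Real.norm_eq_abs, ENNReal.toReal_mul, ENNReal.toReal_ofReal hB0] at h3

end InverseLaplacian

/-! ### Scalar inequalities for the excess and the nonlinearities -/

section Scalar

/-- The signed distance `min s 0 + max (s - 1) 0` of `s` to the interval `[0, 1]`. -/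
def excess (s : ℝ) : ℝ := min s 0 + max (s - 1) 0

lemma excess_of_nonpos {s : ℝ} (h : s ≤ 0) : excess s = s := by
  rw [excess, min_eq_left h, max_eq_right (by linarith), add_zero]

lemma excess_of_mem {s : ℝ} (h0 : 0 ≤ s) (h1 : s ≤ 1) : excess s = 0 := by
  rw [excess, min_eq_right h0, max_eq_right (by linarith), add_zero]

lemma excess_of_one_le {s : ℝ} (h : 1 ≤ s) : excess s = s - 1 := by
  rw [excess, min_eq_right (by linarith), max_eq_left (by linarith), zero_add]

lemma mem_of_excess_eq_zero {s : ℝ} (h : excess s = 0) : 0 ≤ s ∧ s ≤ 1 := by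
  constructor <;> by_contra! hs
  · rw [excess_of_nonpos hs.le] at h
    linarith
  · rw [excess_of_one_le hs.le] at h
    linarith

lemma continuous_excess : Continuous excess := by
  unfold excess
  fun_prop

lemma excess_sub_mul_nonneg (a b : ℝ) : 0 ≤ (a - b) * (excess a - excess b) := by
  have key : ∀ a b : ℝ, a ≤ b → excess a ≤ excess b := fun a b h =>
    add_le_add (min_le_min_right 0 h) (max_le_max_right 0 (by linarith))
  rcases le_total a b with h | h
  · exact mul_nonneg_of_nonpos_of_nonpos (by linarith) (by linarith [key a b h])
  · exact mul_nonneg (by linarith) (by linarith [key b a h])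

lemma abs_excess_sub_le (a b : ℝ) : |excess a - excess b| ≤ |a - b| := by
  have key : ∀ a b : ℝ, a ≤ b → |excess a - excess b| ≤ |a - b| := by
    intro a b h
    rw [abs_sub_comm (excess a), abs_sub_comm a, abs_of_nonneg (sub_nonneg.2 h), abs_le]
    unfold excess
    grind
  rcases le_total a b with h | h
  · exact key a b h
  · rw [abs_sub_comm, abs_sub_comm a]
    exact key b a h

lemma abs_excess_le (a : ℝ) : |excess a| ≤ |a| := by
  have h := abs_excess_sub_le a 0
  rwa [excess_of_nonpos le_rfl, sub_zero, sub_zero] at h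

lemma sub_excess_mem (s : ℝ) : 0 ≤ s - excess s ∧ s - excess s ≤ 1 := by
  rcases le_total s 0 with h | h
  · rw [excess_of_nonpos h]
    norm_num
  · rcases le_total s 1 with h1 | h1
    · rw [excess_of_mem h h1]
      simpa using ⟨h, h1⟩
    · rw [excess_of_one_le h1]
      norm_num

/-- The convexity of `excess ^ 2 / 2`, whose derivative is `excess`. -/
lemma excess_sq_sub_le (a b : ℝ) :
    excess b ^ 2 / 2 - excess a ^ 2 / 2 ≤ excess b * (b - a) := by
  have ha := sub_excess_mem a
  have h : 0 ≤ excess b * ((b - excess b) - (a - excess a)) := by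
    rcases le_total b 0 with hb | hb
    · rw [excess_of_nonpos hb]
      exact mul_nonneg_of_nonpos_of_nonpos hb (by linarith)
    · rcases le_total b 1 with hb1 | hb1
      · rw [excess_of_mem hb hb1, zero_mul]
      · rw [excess_of_one_le hb1]
        exact mul_nonneg (by linarith) (by linarith)
  nlinarith [sq_nonneg (excess b - excess a)]

lemma deriv_doubleWell (s : ℝ) : deriv doubleWell s = 36 * (s ^ 2 - s) * (2 * s - 1) := by
  have h : HasDerivAt doubleWell (18 * (2 * (s ^ 2 - s) * (2 * s - 1))) s := by
    have h1 : HasDerivAt (fun s : ℝ => s ^ 2 - s) (2 * s - 1) s := by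
      simpa using! (hasDerivAt_pow 2 s).sub (hasDerivAt_id s)
    simpa using! (h1.pow 2).const_mul 18
  rw [h.deriv]
  ring

lemma deriv_fPoly (s : ℝ) : deriv fPoly s = 6 * s - 6 * s ^ 2 := by
  have h : HasDerivAt fPoly (3 * (2 * s) - 2 * (3 * s ^ 2)) s := by
    have h1 := ((hasDerivAt_pow 2 s).const_mul 3).sub ((hasDerivAt_pow 3 s).const_mul 2)
    simpa using! h1
  rw [h.deriv]
  ring

lemma fExt_mem (s : ℝ) : 0 ≤ fExt s ∧ fExt s ≤ 1 := by
  unfold fExt fPoly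
  split_ifs with h0 h1
  · norm_num
  · push Not at h0
    constructor
    · nlinarith [mul_nonneg (sq_nonneg s) (by linarith : 0 ≤ 3 - 2 * s)]
    · nlinarith [mul_nonneg (sq_nonneg (1 - s)) (by linarith : 0 ≤ 1 + 2 * s)]
  · norm_num

lemma measurable_fExt : Measurable fExt := by
  unfold fExt fPoly
  refine Measurable.ite measurableSet_Iio measurable_const
    (Measurable.ite measurableSet_Iic ?_ measurable_const)
  fun_prop

/-- Since `s - excess s` is the projection of `s` onto `[0, 1]`, Lipschitz bounds for `fExt` reduce
to those of the polynomial on `[0, 1]`. -/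
lemma fExt_eq_fPoly (s : ℝ) : fExt s = fPoly (s - excess s) := by
  unfold fExt
  split_ifs with h0 h1
  · rw [excess_of_nonpos h0.le, sub_self]
    norm_num [fPoly]
  · rw [excess_of_mem (not_lt.1 h0) h1, sub_zero]
  · rw [excess_of_one_le (not_le.1 h1).le, sub_sub_cancel]
    norm_num [fPoly]

lemma abs_sub_excess_sub_le (a b : ℝ) : |(a - excess a) - (b - excess b)| ≤ |a - b| := by
  have h1 := excess_sub_mul_nonneg a b
  have h2 := abs_excess_sub_le a b
  rw [← sq_le_sq] at h2 ⊢
  rcases le_total (a - b) 0 with h | h <;> nlinarith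

lemma abs_fPoly_sub_le {a b : ℝ} (ha : 0 ≤ a ∧ a ≤ 1) (hb : 0 ≤ b ∧ b ≤ 1) :
    |fPoly a - fPoly b| ≤ 2 * |a - b| := by
  have h : fPoly a - fPoly b = (3 * (a + b) - 2 * (a ^ 2 + a * b + b ^ 2)) * (a - b) := by
    unfold fPoly
    ring
  rw [h, abs_mul]
  gcongr
  rw [abs_le]
  constructor
  · nlinarith [mul_nonneg ha.1 (sub_nonneg.2 ha.2), mul_nonneg hb.1 (sub_nonneg.2 hb.2),
      mul_nonneg ha.1 (sub_nonneg.2 hb.2), mul_nonneg hb.1 (sub_nonneg.2 ha.2)]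
  · nlinarith [sq_nonneg (a - b), sq_nonneg (a + b - 1)]

lemma abs_fExt_sub_le (a b : ℝ) : |fExt a - fExt b| ≤ 2 * |a - b| := by
  rw [fExt_eq_fPoly, fExt_eq_fPoly]
  exact (abs_fPoly_sub_le (sub_excess_mem a) (sub_excess_mem b)).trans
    (mul_le_mul_of_nonneg_left (abs_sub_excess_sub_le a b) (by norm_num))

/-- Follows from the Lipschitz bound, so nothing is computed at the junction points `0` and `1`. -/
lemma abs_deriv_fExt_le (s : ℝ) : |deriv fExt s| ≤ 2 :=
  norm_deriv_le_of_lip' (f := fExt) (x₀ := s) zero_le_two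
    (.of_forall fun x => abs_fExt_sub_le x s)

lemma deriv_fExt_of_neg {s : ℝ} (hs : s < 0) : deriv fExt s = 0 := by
  have h : fExt =ᶠ[𝓝 s] fun _ => 0 := by
    filter_upwards [Iio_mem_nhds hs] with x hx
    exact if_pos hx
  rw [h.deriv_eq, deriv_const]

lemma deriv_fExt_of_one_lt {s : ℝ} (hs : 1 < s) : deriv fExt s = 0 := by
  have h : fExt =ᶠ[𝓝 s] fun _ => 1 := by
    filter_upwards [Ioi_mem_nhds hs] with x hx
    rw [Set.mem_Ioi] at hx
    unfold fExt
    rw [if_neg (by linarith), if_neg (by linarith)]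
  rw [h.deriv_eq, deriv_const]

lemma deriv_cutoff_measurable {df : ℝ → ℝ} (hdf : df = deriv fExt ∨ df = deriv fPoly) :
    Measurable df := by
  rcases hdf with rfl | rfl <;> exact measurable_deriv _

/-- A crude bound covering both choices of `df`, with the cubic growth of `W'` so that the two can
be added. -/
lemma abs_deriv_cutoff_le {df : ℝ → ℝ} (hdf : df = deriv fExt ∨ df = deriv fPoly) (s : ℝ) :
    |df s| ≤ 12 * (1 + |s| ^ 3) := by
  have h3 : 0 ≤ |s| ^ 3 := by positivity
  rcases hdf with rfl | rfl
  · linarith [abs_deriv_fExt_le s]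
  · rw [deriv_fPoly]
    have h1 := abs_sub (6 * s) (6 * s ^ 2)
    have h2 : |6 * s| = 6 * |s| := by rw [abs_mul, abs_of_pos (by norm_num : (0 : ℝ) < 6)]
    have h4 : |6 * s ^ 2| = 6 * |s| ^ 2 := by
      rw [abs_mul, abs_of_pos (by norm_num : (0 : ℝ) < 6), abs_pow]
    rw [h2, h4] at h1
    have h0 := abs_nonneg s
    nlinarith [mul_nonneg h0 (sq_nonneg (|s| - 1)), mul_nonneg h0 (sq_nonneg |s|),
      sq_nonneg (|s| - 1), mul_nonneg (by linarith : 0 ≤ |s| + 1) (sq_nonneg (|s| - 1))]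

lemma abs_deriv_doubleWell_le (s : ℝ) : |deriv doubleWell s| ≤ 216 * (1 + |s| ^ 3) := by
  rw [deriv_doubleWell, show 36 * (s ^ 2 - s) * (2 * s - 1) = 72 * s ^ 3 - 108 * s ^ 2 + 36 * s by
    ring]
  have h1 : |72 * s ^ 3 - 108 * s ^ 2 + 36 * s| ≤ 72 * |s| ^ 3 + 108 * |s| ^ 2 + 36 * |s| := by
    refine (abs_add_le _ _).trans ?_
    refine (add_le_add_left (abs_sub _ _) _).trans_eq ?_
    simp only [abs_mul, abs_pow]
    norm_num
  have h0 := abs_nonneg s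
  nlinarith [mul_nonneg (by linarith : 0 ≤ |s| + 1) (sq_nonneg (|s| - 1)), sq_nonneg (|s| - 1),
    mul_nonneg h0 (sq_nonneg (|s| - 1)), mul_nonneg h0 (sq_nonneg |s|)]

/-- The double well dominates the nonlocal terms outside `[0, 1]`. -/
lemma reaction_mul_excess_nonpos {df : ℝ → ℝ} (hdf : df = deriv fExt ∨ df = deriv fPoly)
    {ε c : ℝ} (hε : 0 < ε) (hc : |c| ≤ 6 / ε) (s : ℝ) :
    (-(1 / ε * deriv doubleWell s) - c * df s) * excess s ≤ 0 := by
  have hi : 0 < 1 / ε := by positivity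
  have hc' : |c| ≤ 6 * (1 / ε) := by rwa [mul_one_div]
  rw [abs_le] at hc'
  rw [deriv_doubleWell]
  set i := 1 / ε
  rcases lt_or_ge s 0 with h | h
  · rw [excess_of_nonpos h.le]
    have hdf' : df s = 0 ∨ df s = 6 * s - 6 * s ^ 2 := by
      rcases hdf with rfl | rfl
      · exact Or.inl (deriv_fExt_of_neg h)
      · exact Or.inr (deriv_fPoly s)
    have hs : 0 < s ^ 2 * (1 - s) := mul_pos (sq_pos_iff.2 h.ne) (by linarith)
    rcases hdf' with h1 | h1 <;> rw [h1]
    · have : 0 ≤ i * (s ^ 2 * (1 - s)) * (1 - 2 * s) :=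
        mul_nonneg (by positivity) (by linarith)
      nlinarith
    · have h2 : 0 ≤ (6 * i + c) * (s ^ 2 * (1 - s)) := mul_nonneg (by linarith) hs.le
      have h3 : 0 ≤ i * (s ^ 2 * (1 - s)) * (-s) := mul_nonneg (by positivity) (by linarith)
      nlinarith
  rcases le_or_gt s 1 with h' | h'
  · rw [excess_of_mem h h', mul_zero]
  · rw [excess_of_one_le h'.le]
    have hdf' : df s = 0 ∨ df s = 6 * s - 6 * s ^ 2 := by
      rcases hdf with rfl | rfl
      · exact Or.inl (deriv_fExt_of_one_lt h')
      · exact Or.inr (deriv_fPoly s)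
    have hs : 0 < s * (s - 1) ^ 2 := mul_pos (by linarith) (pow_pos (by linarith) 2)
    rcases hdf' with h1 | h1 <;> rw [h1]
    · have : 0 ≤ i * (s * (s - 1) ^ 2) * (2 * s - 1) :=
        mul_nonneg (by positivity) (by linarith)
      nlinarith
    · have h2 : 0 ≤ (6 * i - c) * (s * (s - 1) ^ 2) := mul_nonneg (by linarith) hs.le
      have h3 : 0 ≤ i * (s * (s - 1) ^ 2) * (s - 1) := mul_nonneg (by positivity) (by linarith)
      nlinarith

/-- A form of Young's inequality with a small factor `δ`. -/
lemma mul_le_small_mul_add {l a D δ : ℝ} (ha : 0 ≤ a) (hD : 0 ≤ D) (hδ : 0 < δ) :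
    (l + (1 + a ^ 3)) * D ≤ 3 * (δ * (l ^ 2 + 1 + a ^ 4) + D ^ 4 / δ ^ 3) := by
  have h1 : l * D ≤ δ * l ^ 2 + D ^ 2 / δ := by
    rw [← sub_nonneg]
    have : δ * l ^ 2 + D ^ 2 / δ - l * D = δ * ((l - D / δ / 2) ^ 2) + 3 / 4 * (D ^ 2 / δ) := by
      field_simp
      ring
    rw [this]
    positivity
  -- `D² / δ` is the geometric mean of `δ` and `D⁴ / δ³`.
  have h2 : D ^ 2 / δ ≤ δ / 2 + D ^ 4 / δ ^ 3 / 2 := by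
    rw [← sub_nonneg]
    have : δ / 2 + D ^ 4 / δ ^ 3 / 2 - D ^ 2 / δ = δ / 2 * (1 - D ^ 2 / δ ^ 2) ^ 2 := by
      field_simp
      ring
    rw [this]
    positivity
  have h3 : D ≤ δ + D ^ 4 / δ ^ 3 := by
    rcases le_total D δ with h | h
    · have : 0 ≤ D ^ 4 / δ ^ 3 := by positivity
      linarith
    · have : D ≤ D ^ 4 / δ ^ 3 := by
        rw [le_div_iff₀ (by positivity), pow_succ' D 3]
        gcongr
      linarith
  have h4 : a ^ 3 * D ≤ δ * a ^ 4 + D ^ 4 / δ ^ 3 := by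
    rcases le_total D (δ * a) with h | h
    · have : a ^ 3 * D ≤ a ^ 3 * (δ * a) := by gcongr
      have : 0 ≤ D ^ 4 / δ ^ 3 := by positivity
      nlinarith
    · have : a ^ 3 * D ≤ D ^ 4 / δ ^ 3 := by
        rw [le_div_iff₀ (by positivity)]
        calc a ^ 3 * D * δ ^ 3 = (δ * a) ^ 3 * D := by ring
          _ ≤ D ^ 3 * D := by gcongr
          _ = D ^ 4 := by ring
      have : 0 ≤ δ * a ^ 4 := by positivity
      linarith
  have h5 : 0 ≤ δ * l ^ 2 := by positivity
  have h6 : 0 ≤ δ * a ^ 4 := by positivity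
  have h7 : 0 ≤ D ^ 4 / δ ^ 3 := by positivity
  calc (l + (1 + a ^ 3)) * D = l * D + D + a ^ 3 * D := by ring
    _ ≤ 3 * (δ * l ^ 2 + δ + δ * a ^ 4 + D ^ 4 / δ ^ 3) := by linarith
    _ = _ := by ring

end Scalar

/-! ### The right-hand side at a fixed time -/

section SpatialEstimate

variable {d : ℕ} {X : Fin d → ℝ} [∀ i, Fact (0 < 2 * X i)]

lemma integrable_pow_four {u : Torus X → ℝ} (hu : MemLp u 4 volume) :
    Integrable fun x => u x ^ 4 := by
  have h := MemLp.integrable_norm_pow (p := 4) (by exact_mod_cast hu) (by norm_num)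
  refine h.congr (.of_forall fun x => ?_)
  exact Even.pow_abs (by decide) _

lemma memLp_two_of_four {u : Torus X → ℝ} (hu : MemLp u 4 volume) : MemLp u 2 volume :=
  hu.mono_exponent (by norm_num)

lemma memLp_excess {p : ℝ≥0∞} {u : Torus X → ℝ} (hu : MemLp u p volume) :
    MemLp (fun x => excess (u x)) p volume :=
  hu.mono (continuous_excess.comp_aestronglyMeasurable hu.1) (.of_forall fun _ => abs_excess_le _)

lemma aestronglyMeasurable_rhs {ε γ M ω : ℝ} {df : ℝ → ℝ} (hdf : Measurable df)
    {u : Torus X → ℝ} (hu : AEStronglyMeasurable u volume) :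
    AEStronglyMeasurable (rhs ε γ M ω df u) volume := by
  have h1 : AEStronglyMeasurable (fun x => df (u x)) volume :=
    (hdf.comp_aemeasurable hu.aemeasurable).aestronglyMeasurable
  have h2 : AEStronglyMeasurable (fun x => deriv doubleWell (u x)) volume :=
    ((measurable_deriv doubleWell).comp_aemeasurable hu.aemeasurable).aestronglyMeasurable
  have h3 : AEStronglyMeasurable (lap u) volume := aestronglyMeasurable_multiplier _ u
  have h4 := aestronglyMeasurable_invLap (fun y => fExt (u y) - ω)
  exact (((h3.const_mul ε).sub (h2.const_mul _)).sub ((h4.const_mul γ).mul h1)).sub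
    (h1.const_mul _)

/-- The nonlocal factor `γ (-Δ)⁻¹(f(u) - ω) + M ∫ (f(u) - ω)` is bounded by `6 / ε`. -/
lemma ae_abs_nonlocal_le {ε γ M ω : ℝ} (hε : 0 < ε) (hγ : 0 < γ) (hM : 0 < M) (hω₀ : 0 < ω)
    (hcond : ENNReal.ofReal (ε * max ω (1 - ω) / 6) *
      (ENNReal.ofReal γ * invLapNorm X +
        ENNReal.ofReal M * volume (Set.univ : Set (Torus X))) ≤ 1)
    {u : Torus X → ℝ} (hu : AEStronglyMeasurable u volume) :
    ∀ᵐ x, |γ * invLap (fun y => fExt (u y) - ω) x + M * ∫ y, (fExt (u y) - ω)| ≤ 6 / ε := by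
  set B := max ω (1 - ω) with hBdef
  have hB : 0 < B := lt_max_of_lt_left hω₀
  have hB6 : 0 < ε * B / 6 := by positivity
  -- Finiteness of the norm is contained in `hcond`, because its coefficients are positive.
  have hN : invLapNorm X ≠ ∞ := by
    intro h
    rw [h, ENNReal.mul_top (by simpa using hγ), top_add, ENNReal.mul_top (by simpa using hB6)]
      at hcond
    exact absurd hcond (by simp)
  have hreal : ε * B / 6 * (γ * (invLapNorm X).toReal +
      M * volume.real (Set.univ : Set (Torus X))) ≤ 1 := by
    have h := ENNReal.toReal_mono ENNReal.one_ne_top hcond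
    rwa [ENNReal.toReal_mul, ENNReal.toReal_add (by finiteness) (by finiteness),
      ENNReal.toReal_mul, ENNReal.toReal_mul, ENNReal.toReal_ofReal hB6.le,
      ENNReal.toReal_ofReal hγ.le, ENNReal.toReal_ofReal hM.le, ENNReal.toReal_one] at h
  have hbd : ∀ x, |fExt (u x) - ω| ≤ B := fun x => by
    have h := fExt_mem (u x)
    have h1 := le_max_left ω (1 - ω)
    have h2 := le_max_right ω (1 - ω)
    rw [abs_le]
    constructor <;> linarith
  have hg : MemLp (fun x => fExt (u x) - ω) ∞ volume :=
    memLp_top_of_bound ((measurable_fExt.comp_aemeasurable hu.aemeasurable).sub_const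
      ω).aestronglyMeasurable B (.of_forall hbd)
  have hint : |∫ y, (fExt (u y) - ω)| ≤ B * volume.real (Set.univ : Set (Torus X)) :=
    norm_integral_le_of_norm_le_const (f := fun y => fExt (u y) - ω) (.of_forall hbd)
  filter_upwards [ae_abs_invLap_le hN hg (.of_forall hbd)] with x hx
  calc _ ≤ γ * |invLap (fun y => fExt (u y) - ω) x| + M * |∫ y, (fExt (u y) - ω)| := by
        refine (abs_add_le _ _).trans_eq ?_
        rw [abs_mul, abs_mul, abs_of_pos hγ, abs_of_pos hM]
    _ ≤ γ * ((invLapNorm X).toReal * B) + M * (B * volume.real (Set.univ : Set (Torus X))) := by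
        gcongr
    _ ≤ 6 / ε := by
        rw [le_div_iff₀ hε]
        linarith

/-- The right-hand side tested with the excess of a nearby function. -/
lemma integral_rhs_mul_excess_le {ε γ M ω : ℝ} (hε : 0 < ε) (hγ : 0 < γ) (hM : 0 < M)
    (hω₀ : 0 < ω)
    (hcond : ENNReal.ofReal (ε * max ω (1 - ω) / 6) *
      (ENNReal.ofReal γ * invLapNorm X +
        ENNReal.ofReal M * volume (Set.univ : Set (Torus X))) ≤ 1)
    {df : ℝ → ℝ} (hdf : df = deriv fExt ∨ df = deriv fPoly)
    {u v : Torus X → ℝ} (hu : MemLp u 4 volume) (hv : MemLp v 4 volume)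
    (hS : sobolevSq 2 u < ∞) {δ : ℝ} (hδ : 0 < δ) :
    ∫ x, rhs ε γ M ω df u x * excess (v x) ≤ 3 * (ε + 288 / ε) *
      (δ * ((sobolevSq 2 u).toReal + volume.real (Set.univ : Set (Torus X)) + ∫ x, u x ^ 4) +
        (∫ x, (v x - u x) ^ 4) / δ ^ 3) := by
  -- `288 = 216 + 6 · 12`: the growth constant of `W'`, plus the bound `6 / ε` times the growth
  -- constant of `df`.
  set K := ε + 288 / ε with hK
  have hKε : ε ≤ K := le_add_of_nonneg_right (by positivity)
  have hK0 : 0 < K := by positivity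
  have hc := ae_abs_nonlocal_le hε hγ hM hω₀ hcond hu.1
  have hrhs : ∀ x, rhs ε γ M ω df u x = ε * lap u x + (-(1 / ε * deriv doubleWell (u x)) -
      (γ * invLap (fun y => fExt (u y) - ω) x + M * ∫ y, (fExt (u y) - ω)) * df (u x)) := by
    intro x
    unfold rhs
    ring
  have habs : ∀ᵐ x, |rhs ε γ M ω df u x| ≤ K * (|lap u x| + (1 + |u x| ^ 3)) := by
    filter_upwards [hc] with x hx
    rw [hrhs]
    have h3 : 0 ≤ 1 + |u x| ^ 3 := by positivity
    calc _ ≤ |ε * lap u x| + (|1 / ε * deriv doubleWell (u x)| +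
          |(γ * invLap (fun y => fExt (u y) - ω) x + M * ∫ y, (fExt (u y) - ω)) * df (u x)|) := by
          refine (abs_add_le _ _).trans (add_le_add_right ((abs_sub _ _).trans_eq ?_) _)
          rw [abs_neg]
      _ ≤ ε * |lap u x| + (1 / ε * (216 * (1 + |u x| ^ 3)) +
          6 / ε * (12 * (1 + |u x| ^ 3))) := by
          rw [abs_mul, abs_mul, abs_mul, abs_of_pos hε, abs_of_pos (one_div_pos.2 hε)]
          gcongr
          · exact abs_deriv_doubleWell_le _
          · exact abs_deriv_cutoff_le hdf _
      _ = ε * |lap u x| + 288 / ε * (1 + |u x| ^ 3) := by ring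
      _ ≤ K * |lap u x| + K * (1 + |u x| ^ 3) := by
          gcongr
          exact le_add_of_nonneg_left hε.le
      _ = _ := by ring
  have hyoung : ∀ᵐ x, ∀ w r : ℝ, 0 < r → |rhs ε γ M ω df u x| * |w| ≤
      3 * K * (r * (lap u x ^ 2 + 1 + u x ^ 4) + w ^ 4 / r ^ 3) := by
    filter_upwards [habs] with x hx w r hr
    have h := mul_le_small_mul_add (l := |lap u x|) (abs_nonneg (u x)) (abs_nonneg w) hr
    have he : Even 4 := by decide
    rw [sq_abs, he.pow_abs, he.pow_abs] at h
    calc _ ≤ K * (|lap u x| + (1 + |u x| ^ 3)) * |w| := by gcongr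
      _ = K * ((|lap u x| + (1 + |u x| ^ 3)) * |w|) := by ring
      _ ≤ K * (3 * (r * (lap u x ^ 2 + 1 + u x ^ 4) + w ^ 4 / r ^ 3)) :=
        mul_le_mul_of_nonneg_left h hK0.le
      _ = _ := by ring
  have hi1 : Integrable fun x => lap u x ^ 2 := (memLp_lap hS).integrable_sq
  have hi2 := integrable_pow_four hu
  have hi3 : Integrable fun x => (v x - u x) ^ 4 := integrable_pow_four (hv.sub hu)
  have hi4 : Integrable fun x => lap u x * excess (u x) :=
    (memLp_lap hS).integrable_mul (memLp_excess (memLp_two_of_four hu))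
  have hi0 : Integrable fun x => lap u x ^ 2 + 1 := hi1.add (integrable_const 1)
  have hi5 : Integrable fun x => lap u x ^ 2 + 1 + u x ^ 4 :=
    hi0.add hi2
  have hi6 : Integrable fun x => 3 * K * (δ * (lap u x ^ 2 + 1 + u x ^ 4) +
      (v x - u x) ^ 4 / δ ^ 3) :=
    ((hi5.const_mul δ).add (hi3.div_const _)).const_mul _
  have hlhs : Integrable fun x => rhs ε γ M ω df u x * excess (v x) := by
    refine Integrable.mono' (((hi5.const_mul 1).add ((integrable_pow_four
      (memLp_excess hv)).div_const (1 ^ 3))).const_mul (3 * K))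
      ((aestronglyMeasurable_rhs (deriv_cutoff_measurable hdf) hu.1).mul (memLp_excess hv).1) ?_
    filter_upwards [hyoung] with x hx
    rw [norm_mul]
    exact hx _ 1 one_pos
  have hpt : ∀ᵐ x, rhs ε γ M ω df u x * excess (v x) ≤ ε * (lap u x * excess (u x)) +
      3 * K * (δ * (lap u x ^ 2 + 1 + u x ^ 4) + (v x - u x) ^ 4 / δ ^ 3) := by
    filter_upwards [hc, hyoung] with x hx hy
    have h1 := reaction_mul_excess_nonpos hdf hε hx (u x)
    have h2 : rhs ε γ M ω df u x * (excess (v x) - excess (u x)) ≤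
        |rhs ε γ M ω df u x| * |v x - u x| := by
      refine (le_abs_self _).trans ?_
      rw [abs_mul]
      exact mul_le_mul_of_nonneg_left (abs_excess_sub_le _ _) (abs_nonneg _)
    -- On the diagonal only the Laplacian survives: the reaction terms have the good sign pointwise.
    have h3 : rhs ε γ M ω df u x * excess (u x) ≤ ε * (lap u x * excess (u x)) := by
      rw [hrhs, add_mul, mul_assoc]
      linarith
    linarith [hy (v x - u x) δ hδ]
  have hlap : ∫ x, lap u x * excess (u x) ≤ 0 :=
    integral_lap_mul_nonpos (memLp_two_of_four hu) (memLp_excess (memLp_two_of_four hu)) hS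
      fun x y => excess_sub_mul_nonneg _ _
  calc _ ≤ ∫ x, (ε * (lap u x * excess (u x)) +
        3 * K * (δ * (lap u x ^ 2 + 1 + u x ^ 4) + (v x - u x) ^ 4 / δ ^ 3)) :=
        integral_mono_ae hlhs ((hi4.const_mul ε).add hi6) hpt
    _ = ε * (∫ x, lap u x * excess (u x)) + 3 * K * (δ * ((∫ x, lap u x ^ 2) +
        volume.real (Set.univ : Set (Torus X)) + ∫ x, u x ^ 4) +
          (∫ x, (v x - u x) ^ 4) / δ ^ 3) := by
        rw [integral_add (hi4.const_mul ε) hi6, integral_const_mul, integral_const_mul,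
          integral_add (hi5.const_mul δ) (hi3.div_const _), integral_const_mul, integral_div,
          integral_add hi0 hi2, integral_add hi1 (integrable_const 1)]
        simp
    _ ≤ 0 + 3 * K * (δ * ((sobolevSq 2 u).toReal + volume.real (Set.univ : Set (Torus X)) +
          ∫ x, u x ^ 4) + (∫ x, (v x - u x) ^ 4) / δ ^ 3) := by
        gcongr
        · exact mul_nonpos_of_nonneg_of_nonpos hε.le hlap
        · exact integral_sq_lap_le hS
    _ = _ := zero_add _

end SpatialEstimate

/-! ### From distributional inequalities in time to increments -/

section Time

/-- The smooth step from `0` to `1` on the interval `[c, c + h]`. -/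
def smoothStep (c h : ℝ) (x : ℝ) : ℝ := Real.smoothTransition ((x - c) / h)

lemma contDiff_smoothStep (c h : ℝ) : ContDiff ℝ (⊤ : ℕ∞) (smoothStep c h) :=
  Real.smoothTransition.contDiff.comp ((contDiff_id.sub contDiff_const).div_const h)

lemma monotone_smoothStep (c : ℝ) {h : ℝ} (hh : 0 < h) : Monotone (smoothStep c h) :=
  fun _ _ hxy => Real.smoothTransition.monotone (by gcongr)

lemma smoothStep_of_le {c h x : ℝ} (hh : 0 < h) (hx : x ≤ c) : smoothStep c h x = 0 :=
  Real.smoothTransition.zero_of_nonpos (div_nonpos_of_nonpos_of_nonneg (by linarith) hh.le)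

lemma smoothStep_of_ge {c h x : ℝ} (hh : 0 < h) (hx : c + h ≤ x) : smoothStep c h x = 1 :=
  Real.smoothTransition.one_of_one_le ((one_le_div hh).2 (by linarith))

lemma deriv_smoothStep_eq_zero {c h x : ℝ} (hh : 0 < h) (hx : x ∉ Set.Icc c (c + h)) :
    deriv (smoothStep c h) x = 0 := by
  rw [Set.mem_Icc, not_and_or, not_le, not_le] at hx
  rcases hx with hx | hx
  · have : smoothStep c h =ᶠ[𝓝 x] fun _ => 0 := by
      filter_upwards [Iio_mem_nhds hx] with y hy
      exact smoothStep_of_le hh (le_of_lt hy)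
    rw [this.deriv_eq, deriv_const]
  · have : smoothStep c h =ᶠ[𝓝 x] fun _ => 1 := by
      filter_upwards [Ioi_mem_nhds hx] with y hy
      exact smoothStep_of_ge hh (le_of_lt hy)
    rw [this.deriv_eq, deriv_const]

lemma continuous_deriv_smoothStep (c h : ℝ) : Continuous (deriv (smoothStep c h)) :=
  (contDiff_smoothStep c h).continuous_deriv (by simp)

lemma integral_deriv_smoothStep_mul_eq {c h : ℝ} (hh : 0 < h) (U : ℝ → ℝ) :
    ∫ x, deriv (smoothStep c h) x * U x = ∫ x in c..c + h, deriv (smoothStep c h) x * U x := by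
  rw [intervalIntegral.integral_of_le (by linarith), ← integral_Icc_eq_integral_Ioc,
    setIntegral_eq_integral_of_forall_compl_eq_zero]
  intro x hx
  rw [deriv_smoothStep_eq_zero hh hx, zero_mul]

lemma integrable_deriv_smoothStep_mul {c h : ℝ} (hh : 0 < h) {U : ℝ → ℝ}
    (hU : ContinuousOn U (Set.Icc c (c + h))) :
    Integrable fun x => deriv (smoothStep c h) x * U x := by
  refine (integrableOn_iff_integrable_of_support_subset (s := Set.Icc c (c + h)) ?_).1
    (((continuous_deriv_smoothStep c h).continuousOn.mul hU).integrableOn_Icc)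
  intro x hx
  by_contra hx'
  exact hx (by simp only [deriv_smoothStep_eq_zero hh hx', zero_mul])

lemma integral_deriv_smoothStep (c : ℝ) {h : ℝ} (hh : 0 < h) :
    ∫ x in c..c + h, deriv (smoothStep c h) x = 1 := by
  rw [intervalIntegral.integral_deriv_eq_sub
    (fun x _ => (contDiff_smoothStep c h).differentiable (by simp) x)
    ((continuous_deriv_smoothStep c h).intervalIntegrable _ _), smoothStep_of_ge hh le_rfl,
    smoothStep_of_le hh le_rfl, sub_zero]

/-- The derivative of the step is a probability density on `[c, c + h]`, so the integral is an
average of `U` there. -/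
lemma integral_deriv_smoothStep_mul_le {c h : ℝ} (hh : 0 < h) {U : ℝ → ℝ}
    (hU : ContinuousOn U (Set.Icc c (c + h))) {B : ℝ} (hB : ∀ x ∈ Set.Icc c (c + h), U x ≤ B) :
    ∫ x, deriv (smoothStep c h) x * U x ≤ B := by
  have hch : c ≤ c + h := by linarith
  rw [integral_deriv_smoothStep_mul_eq hh]
  calc _ ≤ ∫ x in c..c + h, deriv (smoothStep c h) x * B := by
        refine intervalIntegral.integral_mono_on hch ?_ ?_ fun x hx =>
          mul_le_mul_of_nonneg_left (hB x hx) (monotone_smoothStep c hh).deriv_nonneg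
        · exact (integrable_deriv_smoothStep_mul hh hU).intervalIntegrable
        · exact ((continuous_deriv_smoothStep c h).mul continuous_const).intervalIntegrable _ _
    _ = B := by
        rw [intervalIntegral.integral_mul_const, integral_deriv_smoothStep c hh, one_mul]

lemma le_integral_deriv_smoothStep_mul {c h : ℝ} (hh : 0 < h) {U : ℝ → ℝ}
    (hU : ContinuousOn U (Set.Icc c (c + h))) {B : ℝ} (hB : ∀ x ∈ Set.Icc c (c + h), B ≤ U x) :
    B ≤ ∫ x, deriv (smoothStep c h) x * U x := by
  have h1 := integral_deriv_smoothStep_mul_le hh hU.neg (B := -B) fun x hx =>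
    neg_le_neg (hB x hx)
  simp only [Pi.neg_apply, mul_neg, integral_neg] at h1
  linarith

/-- A distributional bound on the derivative bounds the increment of a continuous function. -/
lemma sub_le_of_forall_integral_deriv_mul_le {U : ℝ → ℝ} {s t R : ℝ} (hst : s < t)
    (hU : ContinuousOn U (Set.Icc s t))
    (H : ∀ η : ℝ → ℝ, ContDiff ℝ (⊤ : ℕ∞) η → HasCompactSupport η → tsupport η ⊆ Set.Ioo s t →
      (∀ x, 0 ≤ η x) → (∀ x, η x ≤ 1) → -∫ x, deriv η x * U x ≤ R) :
    U t - U s ≤ R := by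
  refine le_of_forall_pos_le_add fun δ hδ => ?_
  have hs := Metric.continuousWithinAt_iff.1 (hU s (Set.left_mem_Icc.2 hst.le)) (δ / 2)
    (by positivity)
  have ht := Metric.continuousWithinAt_iff.1 (hU t (Set.right_mem_Icc.2 hst.le)) (δ / 2)
    (by positivity)
  obtain ⟨r₁, hr₁, hs⟩ := hs
  obtain ⟨r₂, hr₂, ht⟩ := ht
  -- Both transition intervals must lie strictly inside `(s, t)`, be disjoint, and stay where `U` is
  -- within `δ / 2` of its end values.
  set h := min (min r₁ r₂ / 3) ((t - s) / 5) with hdef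
  have hh : 0 < h := lt_min (by positivity) (by linarith)
  have hh1 : 3 * h ≤ r₁ := by
    have := (min_le_left _ _ : h ≤ min r₁ r₂ / 3)
    linarith [min_le_left r₁ r₂]
  have hh2 : 3 * h ≤ r₂ := by
    have := (min_le_left _ _ : h ≤ min r₁ r₂ / 3)
    linarith [min_le_right r₁ r₂]
  have hh3 : 5 * h ≤ t - s := by
    have := (min_le_right _ _ : h ≤ (t - s) / 5)
    linarith
  have hUs : ContinuousOn U (Set.Icc (s + h) (s + h + h)) :=
    hU.mono (Set.Icc_subset_Icc (by linarith) (by linarith))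
  have hUt : ContinuousOn U (Set.Icc (t - 2 * h) (t - 2 * h + h)) :=
    hU.mono (Set.Icc_subset_Icc (by linarith) (by linarith))
  have h1 : ∫ x, deriv (smoothStep (s + h) h) x * U x ≤ U s + δ / 2 := by
    refine integral_deriv_smoothStep_mul_le hh hUs fun x hx => ?_
    have h2 := hs (x := x) ⟨by linarith [hx.1], by linarith [hx.2]⟩ (by
      rw [Real.dist_eq, abs_lt]
      constructor <;> linarith [hx.1, hx.2])
    rw [Real.dist_eq, abs_lt] at h2
    linarith [h2.2]
  have h2 : U t - δ / 2 ≤ ∫ x, deriv (smoothStep (t - 2 * h) h) x * U x := by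
    refine le_integral_deriv_smoothStep_mul hh hUt fun x hx => ?_
    have h2 := ht (x := x) ⟨by linarith [hx.1], by linarith [hx.2]⟩ (by
      rw [Real.dist_eq, abs_lt]
      constructor <;> linarith [hx.1, hx.2])
    rw [Real.dist_eq, abs_lt] at h2
    linarith [h2.1]
  -- A smooth plateau rising on `[s + h, s + 2h]` and falling on `[t - 2h, t - h]`; `-∫ η' U` is
  -- then close to `U t - U s`.
  set η : ℝ → ℝ := fun x => smoothStep (s + h) h x - smoothStep (t - 2 * h) h x with hη
  have hsupp : tsupport η ⊆ Set.Icc (s + h) (t - h) := by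
    refine closure_minimal (fun x hx => ?_) isClosed_Icc
    by_contra hx'
    rw [Set.mem_Icc, not_and_or, not_le, not_le] at hx'
    refine hx ?_
    rcases hx' with hx' | hx'
    · rw [hη]
      simp only
      rw [smoothStep_of_le hh hx'.le, smoothStep_of_le hh (by linarith), sub_zero]
    · rw [hη]
      simp only
      rw [smoothStep_of_ge hh (by linarith), smoothStep_of_ge hh (by linarith), sub_self]
  have hle : ∀ c x, 0 ≤ smoothStep c h x ∧ smoothStep c h x ≤ 1 := fun c x =>
    ⟨Real.smoothTransition.nonneg _, Real.smoothTransition.le_one _⟩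
  have h3 := H η ((contDiff_smoothStep _ _).sub (contDiff_smoothStep _ _))
    (isCompact_Icc.of_isClosed_subset (isClosed_tsupport η) hsupp)
    (hsupp.trans fun x hx => ⟨by linarith [hx.1], by linarith [hx.2]⟩)
    (fun x => by
      rw [hη]
      simp only
      rcases le_total x (t - 2 * h) with hx | hx
      · rw [smoothStep_of_le hh hx, sub_zero]
        exact (hle _ _).1
      · rw [smoothStep_of_ge hh (by linarith : s + h + h ≤ x)]
        exact sub_nonneg.2 (hle _ _).2)
    (fun x => by linarith [(hle (s + h) x).2, (hle (t - 2 * h) x).1])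
  have h4 : ∫ x, deriv η x * U x = (∫ x, deriv (smoothStep (s + h) h) x * U x) -
      ∫ x, deriv (smoothStep (t - 2 * h) h) x * U x := by
    rw [← integral_sub (integrable_deriv_smoothStep_mul hh hUs)
      (integrable_deriv_smoothStep_mul hh hUt)]
    congr 1
    funext x
    rw [← sub_mul]
    congr 1
    exact deriv_fun_sub ((contDiff_smoothStep _ _).differentiable (by simp) x)
      ((contDiff_smoothStep _ _).differentiable (by simp) x)
  rw [h4] at h3
  linarith

/-- A function whose increments over short intervals are small compared with those of an
absolutely continuous one does not increase. -/
lemma le_of_increments_le {E ρ : ℝ → ℝ} {T : ℝ} (hT : 0 < T)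
    (hρ : IntervalIntegrable ρ volume 0 T)
    (H : ∀ δ > 0, ∃ h > 0, ∀ s ∈ Set.Icc 0 T, ∀ t ∈ Set.Icc 0 T, s < t → t - s < h →
      E t - E s ≤ δ * ∫ τ in s..t, ρ τ) : E T ≤ E 0 := by
  have key : ∀ δ > 0, E T - E 0 ≤ δ * ∫ τ in (0 : ℝ)..T, ρ τ := by
    intro δ hδ
    obtain ⟨h, hh, H⟩ := H δ hδ
    obtain ⟨n, hn⟩ := exists_nat_gt (T / h)
    have hn0 : (0 : ℝ) < n := lt_of_le_of_lt (by positivity) hn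
    have hstep : T / n < h := by
      rw [div_lt_iff₀ hh] at hn
      rw [div_lt_iff₀ hn0]
      linarith
    set p : ℕ → ℝ := fun i => i * (T / n) with hp
    have hpos : 0 < T / n := by positivity
    have hpn : p n = T := by
      rw [hp]
      field_simp
    have hp0 : p 0 = 0 := by simp [hp]
    have hmem : ∀ i ≤ n, p i ∈ Set.Icc 0 T := by
      intro i hi
      refine ⟨by positivity, ?_⟩
      rw [← hpn]
      simp only [hp]
      gcongr
    have hsucc : ∀ i, p (i + 1) - p i = T / n := fun i => by
      simp only [hp]
      push_cast
      ring
    have hint : ∀ i < n, IntervalIntegrable ρ volume (p i) (p (i + 1)) := fun i hi =>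
      hρ.mono_set (by
        rw [Set.uIcc_of_le hT.le]
        exact Set.uIcc_subset_Icc (hmem i hi.le) (hmem (i + 1) hi))
    calc E T - E 0 = ∑ i ∈ Finset.range n, (E (p (i + 1)) - E (p i)) := by
          rw [Finset.sum_range_sub (fun i => E (p i)), hpn, hp0]
      _ ≤ ∑ i ∈ Finset.range n, δ * ∫ τ in (p i)..(p (i + 1)), ρ τ := by
          refine Finset.sum_le_sum fun i hi => ?_
          have hi := Finset.mem_range.1 hi
          refine H _ (hmem i hi.le) _ (hmem (i + 1) hi) ?_ ?_ <;> linarith [hsucc i]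
      _ = _ := by
          rw [← Finset.mul_sum, intervalIntegral.sum_integral_adjacent_intervals hint, hpn, hp0]
  set I := ∫ τ in (0 : ℝ)..T, ρ τ
  refine le_of_forall_pos_le_add fun κ hκ => ?_
  have h1 := key (κ / (|I| + 1)) (by positivity)
  have h2 : κ / (|I| + 1) * I ≤ κ := by
    calc κ / (|I| + 1) * I ≤ κ / (|I| + 1) * (|I| + 1) := by
          gcongr
          linarith [le_abs_self I]
      _ = κ := by field_simp
  linarith

end Time

/-! ### Continuity and measurability along a curve in `Lᵖ` -/

section Curve

variable {d : ℕ} {X : Fin d → ℝ} [∀ i, Fact (0 < 2 * X i)]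

open Classical in
/-- A curve of functions as a curve in `Lᵖ`. -/
def curveLp (p : ℝ≥0∞) (φ : ℝ → Torus X → ℝ) (t : ℝ) : Lp ℝ p (volume : Measure (Torus X)) :=
  if h : MemLp (φ t) p volume then h.toLp else 0

lemma curveLp_eq {p : ℝ≥0∞} {φ : ℝ → Torus X → ℝ} {t : ℝ} (h : MemLp (φ t) p volume) :
    curveLp p φ t = h.toLp := dif_pos h

lemma continuousOn_curveLp {p : ℝ≥0∞} [Fact (1 ≤ p)] {φ : ℝ → Torus X → ℝ} {T : ℝ}
    (hφ : ∀ t ∈ Set.Icc 0 T, MemLp (φ t) p volume)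
    (hc : ∀ s ∈ Set.Icc 0 T,
      Tendsto (fun t => eLpNorm (φ t - φ s) p volume) (𝓝[Set.Icc 0 T] s) (𝓝 0)) :
    ContinuousOn (curveLp p φ) (Set.Icc 0 T) := by
  intro s hs
  refine tendsto_iff_edist_tendsto_0.2 ((hc s hs).congr' ?_)
  filter_upwards [self_mem_nhdsWithin] with t ht
  rw [curveLp_eq (hφ t ht), curveLp_eq (hφ s hs), Lp.edist_toLp_toLp]

lemma norm_toLp_pow_four {u : Torus X → ℝ} (hu : MemLp u 4 volume) :
    ‖hu.toLp‖ ^ 4 = ∫ x, u x ^ 4 := by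
  have h0 : 0 ≤ ∫ x, u x ^ 4 := integral_nonneg fun x => by positivity
  have he : Even 4 := by decide
  rw [Lp.norm_toLp, hu.eLpNorm_eq_integral_rpow_norm (by norm_num) (by norm_num)]
  have h1 : (4 : ℝ≥0∞).toReal = ((4 : ℕ) : ℝ) := by norm_num
  simp only [h1, Real.rpow_natCast, Real.norm_eq_abs, he.pow_abs]
  rw [ENNReal.toReal_ofReal (by positivity), Real.rpow_inv_natCast_pow h0 (by norm_num)]

lemma inner_toLp_toLp {u w : Torus X → ℝ} (hu : MemLp u 2 volume) (hw : MemLp w 2 volume) :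
    inner ℝ hu.toLp hw.toLp = ∫ x, u x * w x := by
  rw [L2.inner_def]
  apply integral_congr_ae
  filter_upwards [hu.coeFn_toLp, hw.coeFn_toLp] with x h1 h2
  rw [h1, h2]
  simp [mul_comm]

lemma continuousOn_integral_mul {φ : ℝ → Torus X → ℝ} {I : Set ℝ}
    (hφ : ∀ t ∈ I, MemLp (φ t) 2 volume) (hc : ContinuousOn (curveLp 2 φ) I)
    {w : Torus X → ℝ} (hw : MemLp w 2 volume) :
    ContinuousOn (fun t => ∫ x, φ t x * w x) I := by
  refine (hc.inner (𝕜 := ℝ) (continuousOn_const (c := hw.toLp))).congr fun t ht => ?_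
  simp only [curveLp_eq (hφ t ht), inner_toLp_toLp]

lemma memLp_mode (k : Fin d → ℤ) : MemLp (mode X k) 2 volume :=
  MemLp.of_bound (continuous_mode k).aestronglyMeasurable 1
    (.of_forall fun x => (norm_mode k x).le)

lemma coeff_eq_re_add_im {u : Torus X → ℝ} (hu : MemLp u 2 volume) (k : Fin d → ℤ) :
    coeff u k = ((volume (Set.univ : Set (Torus X))).toReal : ℂ)⁻¹ *
      (((∫ x, u x * (mode X (-k) x).re : ℝ) : ℂ) +
        ((∫ x, u x * (mode X (-k) x).im : ℝ) : ℂ) * Complex.I) := by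
  have h := integral_re_add_im (integrable_ofReal_mul_mode hu (-k))
  rw [coeff, ← h]
  simp

lemma continuousOn_coeff {φ : ℝ → Torus X → ℝ} {I : Set ℝ}
    (hφ : ∀ t ∈ I, MemLp (φ t) 2 volume) (hc : ContinuousOn (curveLp 2 φ) I) (k : Fin d → ℤ) :
    ContinuousOn (fun t => coeff (φ t) k) I := by
  have h1 := continuousOn_integral_mul hφ hc (memLp_mode (X := X) (-k)).re
  have h2 := continuousOn_integral_mul hφ hc (memLp_mode (X := X) (-k)).im
  refine ContinuousOn.congr (ContinuousOn.mul continuousOn_const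
    ((Complex.continuous_ofReal.comp_continuousOn h1).add
      ((Complex.continuous_ofReal.comp_continuousOn h2).mul continuousOn_const)))
    fun t ht => coeff_eq_re_add_im (hφ t ht) k

/-- Each Fourier coefficient is continuous in time, so the Sobolev norm is a countable sum of
measurable functions. -/
lemma aemeasurable_sobolevSq {φ : ℝ → Torus X → ℝ} {I : Set ℝ} (hI : MeasurableSet I)
    (hφ : ∀ t ∈ I, MemLp (φ t) 2 volume) (hc : ContinuousOn (curveLp 2 φ) I) (s : ℕ) :
    AEMeasurable (fun t => sobolevSq s (φ t)) (volume.restrict I) := by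
  unfold sobolevSq
  refine (AEMeasurable.tsum fun k => ?_).const_mul _
  have h := ((continuousOn_coeff hφ hc k).norm.pow 2).const_smul ((1 + waveSq X k) ^ s)
  exact (h.aemeasurable hI).ennreal_ofReal

end Curve

/-! ### Decay of the energy along a weak solution -/

section Solution

variable {d : ℕ} {X : Fin d → ℝ} [∀ i, Fact (0 < 2 * X i)]
  {ε γ M ω : ℝ} {df : ℝ → ℝ} {φ₀ : Torus X → ℝ} {φ : ℝ → Torus X → ℝ}

lemma IsGlobalWeakSolution.continuousOn_curveLp (hφ : IsGlobalWeakSolution ε γ M ω df φ₀ φ)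
    {p : ℝ≥0∞} [Fact (1 ≤ p)] (h2 : 2 ≤ p) (h6 : p < 6) {T : ℝ} (hT : 0 < T) :
    ContinuousOn (curveLp p φ) (Set.Icc 0 T) :=
  ACOK.continuousOn_curveLp (fun t ht => hφ.memLp p h2 h6 t ht.1) (hφ.continuous_Lp p h2 h6 T hT)

lemma IsGlobalWeakSolution.memLp_two (hφ : IsGlobalWeakSolution ε γ M ω df φ₀ φ) {t : ℝ}
    (ht : 0 ≤ t) : MemLp (φ t) 2 volume :=
  hφ.memLp 2 le_rfl (by norm_num) t ht

lemma IsGlobalWeakSolution.memLp_four (hφ : IsGlobalWeakSolution ε γ M ω df φ₀ φ) {t : ℝ}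
    (ht : 0 ≤ t) : MemLp (φ t) 4 volume :=
  hφ.memLp 4 (by norm_num) (by norm_num) t ht

lemma IsGlobalWeakSolution.exists_integral_pow_four_le
    (hφ : IsGlobalWeakSolution ε γ M ω df φ₀ φ) {T : ℝ} (hT : 0 < T) :
    ∃ B, ∀ t ∈ Set.Icc 0 T, ∫ x, φ t x ^ 4 ≤ B := by
  have : Fact (1 ≤ (4 : ℝ≥0∞)) := ⟨by norm_num⟩
  have hc := hφ.continuousOn_curveLp (p := 4) (by norm_num) (by norm_num) hT
  obtain ⟨C, hC⟩ := isCompact_Icc.exists_bound_of_continuousOn hc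
  refine ⟨C ^ 4, fun t ht => ?_⟩
  rw [← norm_toLp_pow_four (hφ.memLp_four ht.1), ← curveLp_eq]
  gcongr
  exact hC t ht

lemma IsGlobalWeakSolution.exists_integral_sub_pow_four_le
    (hφ : IsGlobalWeakSolution ε γ M ω df φ₀ φ) {T : ℝ} (hT : 0 < T) {κ : ℝ} (hκ : 0 < κ) :
    ∃ h > 0, ∀ s ∈ Set.Icc 0 T, ∀ t ∈ Set.Icc 0 T, |t - s| < h →
      ∫ x, (φ t x - φ s x) ^ 4 ≤ κ := by
  have : Fact (1 ≤ (4 : ℝ≥0∞)) := ⟨by norm_num⟩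
  have hc := hφ.continuousOn_curveLp (p := 4) (by norm_num) (by norm_num) hT
  have hu := Metric.uniformContinuousOn_iff.1 (isCompact_Icc.uniformContinuousOn_of_continuous hc)
  -- A number in `[0, 1]` dominates its fourth power, so no fourth root of `κ` is needed.
  obtain ⟨h, hh, hu⟩ := hu (min κ 1) (by positivity)
  refine ⟨h, hh, fun s hs t ht hst => ?_⟩
  have h1 := hu t ht s hs hst
  have ht4 := hφ.memLp_four ht.1
  have hs4 := hφ.memLp_four hs.1
  rw [curveLp_eq ht4, curveLp_eq hs4, dist_eq_norm, ← MemLp.toLp_sub] at h1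
  have h2 : ∫ x, (φ t x - φ s x) ^ 4 = ‖(ht4.sub hs4).toLp‖ ^ 4 :=
    (norm_toLp_pow_four (ht4.sub hs4)).symm
  rw [h2]
  calc ‖(ht4.sub hs4).toLp‖ ^ 4 ≤ min κ 1 ^ 4 := by gcongr
    _ ≤ min κ 1 := pow_le_of_le_one (by positivity) (min_le_right _ _) (by norm_num)
    _ ≤ κ := min_le_left _ _

lemma IsGlobalWeakSolution.integrableOn_sobolevSq (hφ : IsGlobalWeakSolution ε γ M ω df φ₀ φ)
    {T : ℝ} (hT : 0 < T) :
    IntegrableOn (fun t => (sobolevSq 2 (φ t)).toReal) (Set.Ioo 0 T) ∧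
      ∀ᵐ t ∂(volume.restrict (Set.Ioo 0 T)), sobolevSq 2 (φ t) < ∞ := by
  have hm : AEMeasurable (fun t => sobolevSq 2 (φ t)) (volume.restrict (Set.Ioo 0 T)) :=
    aemeasurable_sobolevSq measurableSet_Ioo (fun t ht => hφ.memLp_two ht.1.le)
      ((hφ.continuousOn_curveLp le_rfl (by norm_num) hT).mono Set.Ioo_subset_Icc_self) 2
  have hfin := (hφ.sq_integrable_H2 T hT).ne
  exact ⟨integrable_toReal_of_lintegral_ne_top hm hfin, ae_lt_top' hm hfin⟩

/-- The distributional equation bounds increments of `∫ φ w`; the bound on the right-hand side is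
needed on the time interval only. -/
lemma IsGlobalWeakSolution.integral_mul_sub_le (hφ : IsGlobalWeakSolution ε γ M ω df φ₀ φ)
    {T : ℝ} (hT : 0 < T) {s t : ℝ} (hs : s ∈ Set.Icc 0 T) (ht : t ∈ Set.Icc 0 T) (hst : s < t)
    {w : Torus X → ℝ} (hw : MemLp w 2 volume) {b : ℝ → ℝ} (hb : IntegrableOn b (Set.Ioo 0 T))
    (hb0 : ∀ τ, 0 ≤ b τ)
    (hle : ∀ᵐ τ ∂(volume.restrict (Set.Ioo 0 T)), τ ∈ Set.Ioo s t →
      ∫ x, rhs ε γ M ω df (φ τ) x * w x ≤ b τ) :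
    (∫ x, φ t x * w x) - (∫ x, φ s x * w x) ≤ ∫ τ in s..t, b τ := by
  have hsub : Set.Ioo s t ⊆ Set.Ioo 0 T := Set.Ioo_subset_Ioo hs.1 ht.2
  have hcont : ContinuousOn (fun τ => ∫ x, φ τ x * w x) (Set.Icc s t) :=
    (continuousOn_integral_mul (fun τ hτ => hφ.memLp_two hτ.1)
      (hφ.continuousOn_curveLp le_rfl (by norm_num) hT) hw).mono (Set.Icc_subset_Icc hs.1 ht.2)
  refine sub_le_of_forall_integral_deriv_mul_le hst hcont fun η hη hηc hηs hη0 hη1 => ?_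
  have hη_zero : ∀ τ, τ ∉ Set.Ioo s t → η τ = 0 := fun τ hτ =>
    image_eq_zero_of_notMem_tsupport fun h => hτ (hηs h)
  have h1 := hφ.equation T hT w hw η hη hηc (hηs.trans hsub)
  rw [setIntegral_eq_integral_of_forall_compl_eq_zero] at h1
  swap
  · intro τ hτ
    rw [image_eq_zero_of_notMem_tsupport fun h => hτ (hsub (hηs (tsupport_deriv_subset h))),
      zero_mul]
  rw [h1, intervalIntegral.integral_of_le hst.le, integral_Ioc_eq_integral_Ioo]
  have h2 : ∫ τ in Set.Ioo s t, b τ = ∫ τ in Set.Ioo 0 T, (Set.Ioo s t).indicator b τ := by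
    rw [setIntegral_indicator measurableSet_Ioo, Set.inter_eq_right.2 hsub]
  rw [h2]
  have h0 : ∀ τ, 0 ≤ (Set.Ioo s t).indicator b τ := fun τ =>
    Set.indicator_nonneg (fun τ _ => hb0 τ) τ
  -- Integrability in time of the tested right-hand side is not established. If it fails, the
  -- Bochner integral is `0` and the bound holds because `b ≥ 0`.
  by_cases hint : Integrable (fun τ => η τ * ∫ x, rhs ε γ M ω df (φ τ) x * w x)
      (volume.restrict (Set.Ioo 0 T))
  · refine integral_mono_ae hint (hb.indicator measurableSet_Ioo) ?_
    filter_upwards [hle] with τ hτ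
    by_cases hmem : τ ∈ Set.Ioo s t
    · rw [Set.indicator_of_mem hmem]
      calc _ ≤ η τ * b τ := mul_le_mul_of_nonneg_left (hτ hmem) (hη0 τ)
        _ ≤ 1 * b τ := mul_le_mul_of_nonneg_right (hη1 τ) (hb0 τ)
        _ = b τ := one_mul _
    · rw [hη_zero τ hmem, zero_mul]
      exact h0 τ
  · rw [integral_undef hint]
    exact integral_nonneg h0

/-- The energy `∫ excess(φ)² / 2`, which measures the violation of the bounds `0 ≤ φ ≤ 1`, does not
increase. -/
lemma IsGlobalWeakSolution.integral_sq_excess_le (hφ : IsGlobalWeakSolution ε γ M ω df φ₀ φ)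
    (hε : 0 < ε) (hγ : 0 < γ) (hM : 0 < M) (hω₀ : 0 < ω)
    (hcond : ENNReal.ofReal (ε * max ω (1 - ω) / 6) *
      (ENNReal.ofReal γ * invLapNorm X +
        ENNReal.ofReal M * volume (Set.univ : Set (Torus X))) ≤ 1)
    (hdf : df = deriv fExt ∨ df = deriv fPoly) {T : ℝ} (hT : 0 < T) :
    ∫ x, excess (φ T x) ^ 2 / 2 ≤ ∫ x, excess (φ 0 x) ^ 2 / 2 := by
  obtain ⟨B, hB⟩ := hφ.exists_integral_pow_four_le hT
  obtain ⟨hSint, hSfin⟩ := hφ.integrableOn_sobolevSq hT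
  have hB0 : 0 ≤ B :=
    (integral_nonneg fun x => by positivity).trans (hB 0 (Set.left_mem_Icc.2 hT.le))
  set K := 3 * (ε + 288 / ε) with hK
  have hK0 : 0 < K := by positivity
  -- The final `+ 1` absorbs the error term `r` of the spatial estimate.
  set C := volume.real (Set.univ : Set (Torus X)) + B + 1 with hC
  have hC0 : 0 ≤ C := by positivity
  have hρ : IntegrableOn (fun τ => (sobolevSq 2 (φ τ)).toReal + C) (Set.Ioo 0 T) :=
    hSint.add (integrable_const C)
  refine le_of_increments_le (E := fun t => ∫ x, excess (φ t x) ^ 2 / 2) hT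
    ((intervalIntegrable_iff_integrableOn_Ioo_of_le hT.le).2 hρ) fun δ hδ => ?_
  set r := δ / K with hr
  have hr0 : 0 < r := by positivity
  -- With `κ = r⁴` the term `(∫ (φ(t) - φ(τ))⁴) / r³` is at most `r`, and `K r = δ`.
  obtain ⟨h, hh, hclose⟩ := hφ.exists_integral_sub_pow_four_le hT (κ := r ^ 4) (by positivity)
  refine ⟨h, hh, fun s hs t ht hst hlt => ?_⟩
  have ht4 := hφ.memLp_four ht.1
  have ht2 := hφ.memLp_two ht.1
  have hs2 := hφ.memLp_two hs.1
  have hw := memLp_excess ht2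
  have hconv : (∫ x, excess (φ t x) ^ 2 / 2) - ∫ x, excess (φ s x) ^ 2 / 2 ≤
      (∫ x, φ t x * excess (φ t x)) - ∫ x, φ s x * excess (φ t x) := by
    have i1 : Integrable fun x => excess (φ t x) ^ 2 / 2 := hw.integrable_sq.div_const 2
    have i2 : Integrable fun x => excess (φ s x) ^ 2 / 2 :=
      (memLp_excess hs2).integrable_sq.div_const 2
    have i3 : Integrable fun x => φ t x * excess (φ t x) := ht2.integrable_mul hw
    have i4 : Integrable fun x => φ s x * excess (φ t x) := hs2.integrable_mul hw
    rw [← integral_sub i1 i2, ← integral_sub i3 i4]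
    refine integral_mono (i1.sub i2) (i3.sub i4) fun x => ?_
    have := excess_sq_sub_le (φ s x) (φ t x)
    simp only
    linarith
  refine hconv.trans ?_
  rw [← intervalIntegral.integral_const_mul]
  refine hφ.integral_mul_sub_le hT hs ht hst hw (hρ.const_mul δ)
    (fun τ => by positivity) ?_
  filter_upwards [hSfin, ae_restrict_mem measurableSet_Ioo] with τ hτS hτT hτ
  have h1 := integral_rhs_mul_excess_le hε hγ hM hω₀ hcond hdf (hφ.memLp_four hτT.1.le) ht4 hτS hr0
  have h2 := hB τ ⟨hτT.1.le, hτT.2.le⟩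
  have h3 := hclose τ ⟨hτT.1.le, hτT.2.le⟩ t ht (by
    rw [abs_of_pos (by linarith [hτ.2])]
    linarith [hτ.1])
  have h4 : (∫ x, (φ t x - φ τ x) ^ 4) / r ^ 3 ≤ r := by
    rw [div_le_iff₀ (by positivity)]
    exact h3.trans_eq (by ring)
  calc _ ≤ K * (r * ((sobolevSq 2 (φ τ)).toReal + volume.real (Set.univ : Set (Torus X)) + B) +
        r) := by
        refine h1.trans ?_
        gcongr
    _ = K * r * ((sobolevSq 2 (φ τ)).toReal + C) := by
        rw [hC]
        ring
    _ = δ * ((sobolevSq 2 (φ τ)).toReal + C) := by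
        rw [hr, mul_div_cancel₀ _ hK0.ne']

end Solution

end

end ACOK

/-! ### Conclusion: zero energy forces the bounds -/

theorem mainTheorem1 (d : ℕ) (hd : d = 2 ∨ d = 3)
    (X : Fin d → ℝ) [∀ i, Fact (0 < 2 * X i)]
    (ε γ M ω : ℝ) (hε : 0 < ε) (hγ : 0 < γ) (hM : 0 < M) (hω₀ : 0 < ω) (hω₁ : ω < 1)
    (hcond : ENNReal.ofReal (ε * max ω (1 - ω) / 6) *
      (ENNReal.ofReal γ * ACOK.invLapNorm X +
        ENNReal.ofReal M * MeasureTheory.volume (Set.univ : Set (ACOK.Torus X))) ≤ 1)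
    (df : ℝ → ℝ) (hdf : df = deriv ACOK.fExt ∨ df = deriv ACOK.fPoly)
    (φ₀ : ACOK.Torus X → ℝ) (hφ₀ : ACOK.MemH 1 φ₀)
    (hφ₀_range : ∀ᵐ x, 0 ≤ φ₀ x ∧ φ₀ x ≤ 1)
    (φ : ℝ → ACOK.Torus X → ℝ) (hφ : ACOK.IsGlobalWeakSolution ε γ M ω df φ₀ φ) :
    ∀ t : ℝ, 0 < t → ∀ᵐ x, 0 ≤ φ t x ∧ φ t x ≤ 1 := by
  intro t ht
  have hE := hφ.integral_sq_excess_le hε hγ hM hω₀ hcond hdf ht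
  have h0 : ∫ x, ACOK.excess (φ 0 x) ^ 2 / 2 = 0 := by
    refine integral_eq_zero_of_ae ?_
    filter_upwards [hφ.initial, hφ₀_range] with x hx hx'
    rw [hx, ACOK.excess_of_mem hx'.1 hx'.2]
    norm_num
  have hnonneg : 0 ≤ fun x => ACOK.excess (φ t x) ^ 2 / 2 := fun x => by positivity
  have hint : Integrable fun x => ACOK.excess (φ t x) ^ 2 / 2 :=
    (ACOK.memLp_excess (hφ.memLp_two ht.le)).integrable_sq.div_const 2
  have hz := (integral_eq_zero_iff_of_nonneg hnonneg hint).1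
    (le_antisymm (hE.trans_eq h0) (integral_nonneg hnonneg))
  filter_upwards [hz] with x hx
  refine ACOK.mem_of_excess_eq_zero ?_
  simpa using hx
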